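/- Let $N\ge 1$ and $M\ge 0$ be integers, let $\overline{\mathbb C}=\mathbb C\cup\{\infty\}$, and write $\xi_\pm=\xi_1\pm i\xi_2$, $\partial_\pm=\frac12\left(\frac{\partial}{\partial \xi_1}\mp i\frac{\partial}{\partial \xi_2}\right)$. A matrix function on $\overline{\mathbb C}$ is of class $C^k$ if its components are $C^k$ in the coordinate $\xi=\xi_+$ on $\mathbb C$ and in the coordinate $w=1/\xi$ on $\overline{\mathbb C}\setminus\{0\}$. A matrix function $X$ on $\overline{\mathbb C}$ solves the Euler–Lagrange equation if it is of class $C^2$ and $[\partial_+\partial_-X,X]=0$ on $\mathbb C$; it has finite action if $\operatorname{tr}(\partial_+X\,\partial_-X)$ is integrable on $\mathbb R^2$ with respect to $d\xi_1d\xi_2$. Let $P:\overline{\mathbb C}\to \mathbb C^{N\times N}$ be of class $C^{M+2}$ with values in the rank-one Hermitian projectors ($P^2=P$, $P^\dagger=P$, $\operatorname{tr}P=1$), and suppose that $P$ solves the Euler–Lagrange equation and has finite action. Put $F_\pm=\partial_\pm P\,P\,\partial_\mp P$ on $\mathbb C$. Then for each choice of sign either $F_\pm$ vanishes identically, in which case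 $\Pi_\pm P:=0$; or $\{F_\pm\neq0\}$ is dense in $\mathbb C$, $\operatorname{tr}F_\pm\ne0$ on it, and the quotient $F_\pm/\operatorname{tr}F_\pm$ has a limit along this set at every point of $\overline{\mathbb C}$, in which case $\Pi_\pm P$ is defined to be the continuous extension of the quotient to $\overline{\mathbb C}$. Moreover, for each choice of sign, $\Pi_\pm P$ is either identically $0$ or a rank-one Hermitian projector at every point of $\overline{\mathbb C}$; it is of class $C^{M+1}$ on $\overline{\mathbb C}$, solves the Euler–Lagrange equation, and has finite action. -/

import Mathlib

open scoped Matrix Topology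

noncomputable section

namespace CPModel

/-- Complex `N × N` matrices. -/
abbrev Mat (N : ℕ) : Type := Matrix (Fin N) (Fin N) ℂ

/-- `∂₊ f = ∂f/∂ξ₊ = ½ (∂f/∂ξ₁ - i ∂f/∂ξ₂)`, where `ξ₊ = ξ₁ + i ξ₂` is the coordinate of `ℂ`. -/
def dPlusScalar (f : ℂ → ℂ) (z : ℂ) : ℂ :=
  (1 / 2 : ℂ) * (fderiv ℝ f z 1 - Complex.I * fderiv ℝ f z Complex.I)

/-- `∂₋ f = ∂f/∂ξ₋ = ½ (∂f/∂ξ₁ + i ∂f/∂ξ₂)`, where `ξ₋ = ξ₁ - i ξ₂`. -/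
def dMinusScalar (f : ℂ → ℂ) (z : ℂ) : ℂ :=
  (1 / 2 : ℂ) * (fderiv ℝ f z 1 + Complex.I * fderiv ℝ f z Complex.I)

/-- `∂₊` of a matrix function, componentwise. -/
def dPlus {N : ℕ} (X : ℂ → Mat N) (z : ℂ) : Mat N :=
  Matrix.of fun i j => dPlusScalar (fun w => X w i j) z

/-- `∂₋` of a matrix function, componentwise. -/
def dMinus {N : ℕ} (X : ℂ → Mat N) (z : ℂ) : Mat N :=
  Matrix.of fun i j => dMinusScalar (fun w => X w i j) z

/-- The restriction to the plane `ℂ` of a matrix function on the extended plane `ℂ ∪ {∞}`. -/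
def planePart {N : ℕ} (P : OnePoint ℂ → Mat N) : ℂ → Mat N := fun z => P (z : OnePoint ℂ)

/-- The parametrization `w ↦ ξ = 1/w` of the extended plane minus the origin, with `0 ↦ ∞`. -/
def invChart (w : ℂ) : OnePoint ℂ := if w = 0 then OnePoint.infty else ((w⁻¹ : ℂ) : OnePoint ℂ)

/-- The inversion `P̂(w) = P(1/w)`, with `P̂(0) = P(∞)`. -/
def inversion {N : ℕ} (P : OnePoint ℂ → Mat N) : ℂ → Mat N := fun w => P (invChart w)

/-- `P` is of class `C^k` on the extended plane: its components have continuous real partial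
derivatives up to order `k` in the coordinate `ξ` near each finite point, and in the coordinate
`w = 1/ξ` near each point other than the origin. -/
def IsCk {N : ℕ} (k : ℕ) (P : OnePoint ℂ → Mat N) : Prop :=
  (∀ i j, ContDiff ℝ k fun z => planePart P z i j) ∧
    ∀ i j, ContDiff ℝ k fun w => inversion P w i j

/-- Rank-one Hermitian projectors. -/
structure IsRankOneProjector {N : ℕ} (A : Mat N) : Prop where
  mul_self : A * A = A
  hermitian : Aᴴ = A
  trace_eq_one : A.trace = 1

/-- `P` is a (classical) solution of the Euler–Lagrange equation `[∂₊∂₋P, P] = 0` on the extended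
plane: it is twice continuously differentiable and satisfies the equation in the plane. (In the
coordinate `w = 1/ξ` the left side is multiplied by `|w|⁻⁴`, so the equation at `∞`
follows by continuity.) -/
structure IsSolution {N : ℕ} (P : OnePoint ℂ → Mat N) : Prop where
  isC2 : IsCk 2 P
  euler_lagrange : ∀ z : ℂ,
    dPlus (dMinus (planePart P)) z * planePart P z
      - planePart P z * dPlus (dMinus (planePart P)) z = 0

/-- The Lagrangian density `L(P) = tr(∂₊P ∂₋P)`. -/
def lagrangian {N : ℕ} (P : OnePoint ℂ → Mat N) (z : ℂ) : ℂ :=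
  (dPlus (planePart P) z * dMinus (planePart P) z).trace

/-- The action, the integral of `L(P)` over the plane, is finite. -/
def HasFiniteAction {N : ℕ} (P : OnePoint ℂ → Mat N) : Prop :=
  MeasureTheory.Integrable (lagrangian P) MeasureTheory.volume

/-- The numerator `∂₊X X ∂₋X` of the raising operator. -/
def raiseNum {N : ℕ} (X : ℂ → Mat N) (z : ℂ) : Mat N := dPlus X z * X z * dMinus X z

/-- The numerator `∂₋X X ∂₊X` of the lowering operator. -/
def lowerNum {N : ℕ} (X : ℂ → Mat N) (z : ℂ) : Mat N := dMinus X z * X z * dPlus X z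

/-- Approach to a point `p` of the extended plane through points of the plane where `F ≠ 0`. -/
def approach {N : ℕ} (F : ℂ → Mat N) (p : OnePoint ℂ) : Filter ℂ :=
  Filter.comap ((↑) : ℂ → OnePoint ℂ) (𝓝 p) ⊓ Filter.principal {z : ℂ | F z ≠ 0}

open Classical in
/-- The matrix function on the extended plane that is `0` if `F` vanishes identically, and that is
the continuous extension of `F / tr F` from the set `{F ≠ 0}` otherwise. -/
def normalized {N : ℕ} (F : ℂ → Mat N) : OnePoint ℂ → Mat N := fun p =>
  if ∀ z, F z = 0 then 0
  else Filter.limUnder (approach F p) fun z => (F z).trace⁻¹ • F z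

/-- The values of `normalized F` are genuine: `F` vanishes identically, or the set `{F ≠ 0}` is
dense, `tr F ≠ 0` on it, and `F / tr F` has a limit along it at each point of the extended
plane. -/
def HasNormalization {N : ℕ} (F : ℂ → Mat N) : Prop :=
  (∀ z, F z = 0) ∨
    (Dense {z : ℂ | F z ≠ 0} ∧ (∀ z, F z ≠ 0 → (F z).trace ≠ 0) ∧
      ∀ p, ∃ A, Filter.Tendsto (fun z => (F z).trace⁻¹ • F z) (approach F p) (𝓝 A))

/-- Where `F ≠ 0`, the function `normalized F` is the quotient `F / tr F`. -/
theorem normalized_coe {N : ℕ} {F : ℂ → Mat N} {z : ℂ} (hF : ContinuousAt F z) (hz : F z ≠ 0)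
    (ht : (F z).trace ≠ 0) :
    normalized F (z : OnePoint ℂ) = (F z).trace⁻¹ • F z := by
  have h0 : ¬ ∀ w, F w = 0 := fun h => hz (h z)
  unfold normalized approach
  rw [if_neg h0, ← OnePoint.isOpenEmbedding_coe.isInducing.nhds_eq_comap]
  have hev : {w : ℂ | F w ≠ 0} ∈ 𝓝 z := hF.eventually_ne hz
  rw [inf_eq_left.2 (Filter.le_principal_iff.2 hev)]
  have htr : ContinuousAt (fun w => (F w).trace) z :=
    (continuous_id.matrix_trace.continuousAt (x := F z)).comp hF
  exact ((htr.inv₀ ht).smul hF).tendsto.limUnder_eq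

/-- The raising operator `Π₊P = ∂₊P P ∂₋P / tr(∂₊P P ∂₋P)`, and `Π₊P = 0` if `∂₊P P ∂₋P` vanishes
identically. At the other zeros of `∂₊P P ∂₋P`, and at `∞`, the value is the limit of the
quotient. -/
def raise {N : ℕ} (P : OnePoint ℂ → Mat N) : OnePoint ℂ → Mat N :=
  normalized (raiseNum (planePart P))

/-- The lowering operator `Π₋P = ∂₋P P ∂₊P / tr(∂₋P P ∂₊P)`, and `Π₋P = 0` if `∂₋P P ∂₊P` vanishes
identically. At the other zeros of `∂₋P P ∂₊P`, and at `∞`, the value is the limit of the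
quotient. -/
def lower {N : ℕ} (P : OnePoint ℂ → Mat N) : OnePoint ℂ → Mat N :=
  normalized (lowerNum (planePart P))

end CPModel

end

/-!
Write `A = ∂₊P P` for a solution `P` with values in the rank-one projectors. The numerator of the
raising operator is `A A*`, and the Euler–Lagrange equation for `P` gives `∂₋A = [A, ∂₋P]`,
a linear equation of Cauchy–Riemann type for `A` (`IsHarmonicIdempotent.delMinus_delPlus_mul`).
As `P` commutes with `∂₋P ∂₊P`, this can also be written `∂₋A = [A, A*]`
(`IsHarmonicProjector.delMinus_secondForm`).

*Zeros.* For every smooth family `L` of linear maps the equation `∂₋g = -g L` has local solutions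
`g` with invertible values (`exists_gauge`). If `∂₋A = L A`, then `g A` is holomorphic. Hence `A`
vanishes identically or has isolated zeros, and near a zero `A = (z - z₀)ⁿ B` with `B` smooth and
`B z₀ ≠ 0` (`eventually_zero_or_eq_pow_smul`, `eq_zero_or_forall_eventually_ne_zero`). In the
quotient `A A* / tr (A A*)` the factor `|z - z₀|²ⁿ` cancels, so it extends smoothly across the
zeros (`IsHarmonicProjector.exists_local_extension`).

*Regularity.* The argument takes place in class `C^∞`: a solution of class `C²` is smooth in each
of the two charts (`IsHarmonicIdempotent.contDiff_infty`), which gives every class `C^k` for the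
image. The analytic tool is the Cauchy transform, the convolution with `1 / (π ζ)`, which inverts
`∂₋` on functions with compact support (`cauchyTransform_delMinus`). In the gauge `g`, the equation
`∂₋u = L u + β` becomes `∂₋(g u) = g β`, so that `u` inherits the regularity of `L` and `β`
(`contDiff_one_delPlus`, `contDiff_of_delMinus_eq`). This is applied to `u = ∂₊∂₊P`.

*The image is a solution.* As `P` has rank one, `A*A = tr (A A*) P`, so that the quotient
`Y = A A* / tr (A A*)` is a projector (`IsHarmonicProjector.isRankOneProjector_quotient`).
Differentiating `Y A = A` gives `∂₋Y Y = -A*`, and applying `∂₊` once more gives the Euler–Lagrange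
equation for `Y` (`IsHarmonicProjector.euler_lagrange_quotient`).

*Globalization.* The equation is invariant under `w = 1/ξ`, and so is the quotient, since the
numerator is only multiplied by a nonvanishing scalar. The planar result for `P (1/w)` therefore
settles the point at infinity (`exists_smooth_normalization`). A function of class `C¹` on the
extended plane has finite action because `tr (∂₊P ∂₋P)` decays like `|ξ|⁻⁴`
(`hasFiniteAction_of_contDiff`). Finally, transposition maps solutions to solutions and turns the
raising into the lowering operator (`lower_eq_transpose_raise`).
-/

namespace CPModel

open MeasureTheory Complex
open scoped Convolution ContDiff

/-! ### The Cauchy transform -/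

section Transform

variable {E : Type*} [NormedAddCommGroup E] [NormedSpace ℂ E]

/-- The first-order operator `c ∂/∂ξ₁ + d ∂/∂ξ₂` with constant complex coefficients. -/
noncomputable def firstOrder (c d : ℂ) (f : ℂ → E) (z : ℂ) : E :=
  c • fderiv ℝ f z 1 + d • fderiv ℝ f z I

/-- `∂₋` for functions with values in a complex normed space. -/
noncomputable abbrev delMinus (f : ℂ → E) : ℂ → E := firstOrder (1 / 2) (I / 2) f

/-- `∂₊` for functions with values in a complex normed space. -/
noncomputable abbrev delPlus (f : ℂ → E) : ℂ → E := firstOrder (1 / 2) (-(I / 2)) f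

/-- The fundamental solution `1 / (π ζ)` of `∂₋`. -/
noncomputable def cauchyKernel (z : ℂ) : ℂ := (Real.pi : ℂ)⁻¹ * z⁻¹

/-- The Cauchy transform, that is, convolution with `1 / (π ζ)`. -/
noncomputable def cauchyTransform (f : ℂ → E) : ℂ → E :=
  cauchyKernel ⋆[ContinuousLinearMap.lsmul ℝ ℂ] f

theorem measurable_cauchyKernel : Measurable cauchyKernel :=
  measurable_inv.const_mul _

theorem locallyIntegrable_cauchyKernel : LocallyIntegrable cauchyKernel := by
  refine locallyIntegrable_of_norm_le_rpow (C := Real.pi⁻¹) (α := 1) ?_ ?_ ?_ ?_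
  · simp
  · simp
  · refine Filter.Eventually.of_forall fun z => ?_
    rw [cauchyKernel, Real.rpow_neg_one, norm_mul, norm_inv, norm_inv]
    simp [abs_of_pos Real.pi_pos]
  · exact measurable_cauchyKernel.aestronglyMeasurable

theorem cauchyTransform_apply (f : ℂ → E) (z : ℂ) :
    cauchyTransform f z = ∫ ζ, cauchyKernel ζ • f (z - ζ) := by
  simp [cauchyTransform, convolution_def]

theorem integrable_cauchyTransform {f : ℂ → E} (hf : Continuous f) (hc : HasCompactSupport f)
    (z : ℂ) : Integrable fun ζ => cauchyKernel ζ • f (z - ζ) := by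
  have := hc.convolutionExists_right (ContinuousLinearMap.lsmul ℝ ℂ)
    locallyIntegrable_cauchyKernel hf z
  simpa [ConvolutionExistsAt] using this

theorem cauchyTransform_add {f g : ℂ → E} (hf : Continuous f) (hfc : HasCompactSupport f)
    (hg : Continuous g) (hgc : HasCompactSupport g) (z : ℂ) :
    cauchyTransform (fun w => f w + g w) z = cauchyTransform f z + cauchyTransform g z := by
  simp only [cauchyTransform_apply, smul_add]
  exact integral_add (integrable_cauchyTransform hf hfc z) (integrable_cauchyTransform hg hgc z)

theorem cauchyTransform_smul [CompleteSpace E] (c : ℂ) (f : ℂ → E) (z : ℂ) :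
    cauchyTransform (fun w => c • f w) z = c • cauchyTransform f z := by
  simp only [cauchyTransform_apply]
  rw [← integral_smul]
  congr 1; ext ζ
  rw [smul_comm]

theorem contDiff_cauchyTransform {n : ℕ∞} {f : ℂ → E} (hf : ContDiff ℝ n f)
    (hc : HasCompactSupport f) : ContDiff ℝ n (cauchyTransform f) :=
  hc.contDiff_convolution_right _ locallyIntegrable_cauchyKernel hf

theorem fderiv_cauchyTransform {f : ℂ → E} (hf : ContDiff ℝ 1 f) (hc : HasCompactSupport f)
    (z v : ℂ) :
    fderiv ℝ (cauchyTransform f) z v = cauchyTransform (fun w => fderiv ℝ f w v) z := by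
  have h := hc.hasFDerivAt_convolution_right (ContinuousLinearMap.lsmul ℝ ℂ)
    locallyIntegrable_cauchyKernel hf z
  unfold cauchyTransform
  rw [h.fderiv, convolution_precompR_apply _ locallyIntegrable_cauchyKernel (hc.fderiv ℝ)
    (hf.continuous_fderiv one_ne_zero)]

theorem continuous_firstOrder {c d : ℂ} {f : ℂ → E} (hf : ContDiff ℝ 1 f) :
    Continuous (firstOrder c d f) := by
  have h := hf.continuous_fderiv one_ne_zero
  unfold firstOrder
  fun_prop

theorem _root_.HasCompactSupport.firstOrder {c d : ℂ} {f : ℂ → E} (hc : HasCompactSupport f) :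
    HasCompactSupport (firstOrder c d f) := by
  refine (hc.fderiv ℝ).mono fun z hz => ?_
  contrapose! hz
  simp only [Function.mem_support, not_not] at hz
  simp [CPModel.firstOrder, hz]

theorem firstOrder_cauchyTransform [CompleteSpace E] {c d : ℂ} {f : ℂ → E} (hf : ContDiff ℝ 1 f)
    (hc : HasCompactSupport f) (z : ℂ) :
    firstOrder c d (cauchyTransform f) z = cauchyTransform (firstOrder c d f) z := by
  have h := hf.continuous_fderiv one_ne_zero
  have hv : ∀ v, HasCompactSupport fun w => fderiv ℝ f w v := fun v =>
    hc.fderiv_apply ℝ v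
  unfold firstOrder
  rw [fderiv_cauchyTransform hf hc, fderiv_cauchyTransform hf hc, ← cauchyTransform_smul,
    ← cauchyTransform_smul, ← cauchyTransform_add]
  · fun_prop
  · exact (hv 1).smul_left (f := fun _ => c)
  · fun_prop
  · exact (hv I).smul_left (f := fun _ => d)

open Real in
/-- The Cauchy–Pompeiu formula. In polar coordinates `ζ = r e^{iθ}` around `z` the integrand
`∂₋f(z - ζ) / (π ζ)` is `-(∂_r + (i / r) ∂_θ) f(z - ζ) / (2 π r)`; the angular derivative
integrates to zero over circles, and the radial one to the value at the centre. -/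
theorem cauchyTransform_delMinus [CompleteSpace E] {f : ℂ → E} (hf : ContDiff ℝ 1 f)
    (hc : HasCompactSupport f) (z : ℂ) : cauchyTransform (delMinus f) z = f z := by
  have hD := hf.continuous_fderiv one_ne_zero
  let e : ℝ → ℂ := fun θ => Real.cos θ + Real.sin θ * I
  have he : Continuous e := by fun_prop
  have hnorm : ∀ θ, ‖e θ‖ = 1 := fun θ => by
    have := Complex.norm_exp_ofReal_mul_I θ
    rwa [Complex.exp_mul_I, ← Complex.ofReal_cos, ← Complex.ofReal_sin] at this
  -- radial and angular parts of the integrand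
  let A : ℝ × ℝ → E := fun p => fderiv ℝ f (z - p.1 * e p.2) (e p.2)
  let B : ℝ × ℝ → E := fun p => fderiv ℝ f (z - p.1 * e p.2) (I * e p.2)
  have hA : Continuous A := by fun_prop
  have hB : Continuous B := by fun_prop
  obtain ⟨R, hR⟩ : ∃ R : ℝ, ∀ w, R < ‖w‖ → f w = 0 ∧ fderiv ℝ f w = 0 := by
    obtain ⟨R, hR⟩ := hc.isCompact.isBounded.exists_norm_le
    refine ⟨R, fun w hw => ?_⟩
    have hw' : w ∉ tsupport f := fun h => absurd (hR w h) (not_le.2 hw)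
    exact ⟨image_eq_zero_of_notMem_tsupport hw',
      by_contra fun h => hw' (support_fderiv_subset ℝ h)⟩
  have hfar : ∀ r θ : ℝ, R + ‖z‖ < |r| → R < ‖z - r * e θ‖ := fun r θ h => by
    have h1 : ‖(r : ℂ) * e θ‖ = |r| := by simp [hnorm]
    have := norm_sub_norm_le ((r : ℂ) * e θ) z
    rw [norm_sub_rev] at this
    linarith
  let S : Set (ℝ × ℝ) := Set.Ioi 0 ×ˢ Set.Ioo (-π) π
  have hint : ∀ H : ℝ × ℝ → E, Continuous H → (∀ r θ, R + ‖z‖ < |r| → H (r, θ) = 0) →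
      IntegrableOn H S := by
    intro H hH h0
    have h1 : IntegrableOn H (Set.Icc 0 (R + ‖z‖) ×ˢ Set.Icc (-π) π) :=
      hH.continuousOn.integrableOn_compact (isCompact_Icc.prod isCompact_Icc)
    refine h1.of_forall_sdiff_eq_zero (measurableSet_Ioi.prod measurableSet_Ioo) ?_
    rintro ⟨r, θ⟩ ⟨⟨h2, h3⟩, h4⟩
    refine h0 r θ (lt_of_not_ge fun h5 => h4 ⟨⟨le_of_lt h2, le_trans (le_abs_self r) h5⟩, ?_⟩)
    exact ⟨h3.1.le, h3.2.le⟩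
  have hAint : IntegrableOn A S := hint A hA fun r θ h => by simp [A, (hR _ (hfar r θ h)).2]
  have hBint : IntegrableOn B S := hint B hB fun r θ h => by simp [B, (hR _ (hfar r θ h)).2]
  have hpath : ∀ r θ : ℝ, HasDerivAt (fun r : ℝ => f (z - r * e θ)) (-A (r, θ)) r := by
    intro r θ
    have h1 : HasDerivAt (fun r : ℝ => z - (r : ℂ) * e θ) (-e θ) r := by
      simpa using ((Complex.ofRealCLM.hasDerivAt (x := r)).mul_const (e θ)).const_sub z
    have := ((hf.differentiable one_ne_zero) (z - r * e θ)).hasFDerivAt.comp_hasDerivAt r h1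
    exact this.congr_deriv (by simp [A])
  have hcirc : ∀ r θ : ℝ, HasDerivAt (fun θ : ℝ => f (z - r * e θ)) (-(r • B (r, θ))) θ := by
    intro r θ
    have h0 : HasDerivAt e (I * e θ) θ := by
      have h1 := (Real.hasDerivAt_cos θ).ofReal_comp
      have h2 := ((Real.hasDerivAt_sin θ).ofReal_comp).mul_const I
      refine (h1.add h2).congr_deriv ?_
      simp only [e]
      push_cast
      linear_combination (-(Complex.sin θ)) * Complex.I_sq
    have h1 : HasDerivAt (fun θ : ℝ => z - (r : ℂ) * e θ) (-(r * (I * e θ))) θ :=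
      (h0.const_mul (r : ℂ)).const_sub z
    have := ((hf.differentiable one_ne_zero) (z - r * e θ)).hasFDerivAt.comp_hasDerivAt θ h1
    refine this.congr_deriv ?_
    have h3 : -((r : ℂ) * (I * e θ)) = -(r • (I * e θ)) := by simp
    rw [h3, map_neg, map_smul]
  have hBzero : ∀ r ∈ Set.Ioi (0 : ℝ), ∫ θ in Set.Ioo (-π) π, B (r, θ) = 0 := by
    intro r hr
    have h1 : ∫ θ in (-π)..π, -(r • B (r, θ)) = 0 := by
      rw [intervalIntegral.integral_eq_sub_of_hasDerivAt (fun θ _ => hcirc r θ)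
        (by apply Continuous.intervalIntegrable; fun_prop)]
      simp [e]
    rw [intervalIntegral.integral_neg, intervalIntegral.integral_smul, neg_eq_zero] at h1
    have h2 := (smul_eq_zero.1 h1).resolve_left (ne_of_gt hr)
    rwa [intervalIntegral.integral_of_le (by linarith [Real.pi_pos]), integral_Ioc_eq_integral_Ioo]
      at h2
  have hAval : ∀ θ : ℝ, ∫ r in Set.Ioi (0 : ℝ), A (r, θ) = f z := by
    intro θ
    have h1 : ContDiff ℝ 1 fun r : ℝ => f (z - r * e θ) := by
      refine hf.comp (contDiff_const.sub (ContDiff.mul ?_ contDiff_const))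
      exact Complex.ofRealCLM.contDiff
    have h2 : HasCompactSupport fun r : ℝ => f (z - r * e θ) := by
      refine HasCompactSupport.intro (isCompact_Icc (a := -(R + ‖z‖)) (b := R + ‖z‖)) fun r hr => ?_
      refine (hR _ (hfar r θ ?_)).1
      by_contra h
      exact hr (abs_le.1 (not_lt.1 h))
    have h3 := h2.integral_Ioi_deriv_eq h1 0
    have h4 : deriv (fun r : ℝ => f (z - r * e θ)) = fun r => -A (r, θ) :=
      funext fun r => (hpath r θ).deriv
    rw [h4, integral_neg, neg_inj] at h3
    simpa using h3
  have hIA : ∫ p in S, A p = (2 * π) • f z := by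
    have h1 : IntegrableOn A S (volume.prod volume) := hAint
    have h2 : ∫ p in S, A p = ∫ θ in Set.Ioo (-π) π, ∫ r in Set.Ioi (0 : ℝ), A (r, θ) := by
      calc ∫ p in S, A p = ∫ p in Set.Ioo (-π) π ×ˢ Set.Ioi (0 : ℝ), A p.swap :=
            (setIntegral_prod_swap (μ := volume) (ν := volume) _ _ A).symm
        _ = _ := setIntegral_prod (μ := volume) (ν := volume) (fun p => A p.swap) h1.swap
    rw [h2]
    simp only [hAval]
    rw [setIntegral_const]
    congr 1
    simp [Real.pi_pos.le]
    ring
  have hIB : ∫ p in S, B p = 0 := by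
    have h1 : IntegrableOn B S (volume.prod volume) := hBint
    calc ∫ p in S, B p = ∫ r in Set.Ioi (0 : ℝ), ∫ θ in Set.Ioo (-π) π, B (r, θ) :=
          setIntegral_prod (μ := volume) (ν := volume) B h1
      _ = ∫ r in Set.Ioi (0 : ℝ), (0 : E) := setIntegral_congr_fun measurableSet_Ioi hBzero
      _ = 0 := by simp
  rw [cauchyTransform_apply, ← Complex.integral_comp_polarCoord_symm]
  have hcongr : ∀ p ∈ S, p.1 • (cauchyKernel (Complex.polarCoord.symm p) •
      delMinus f (z - Complex.polarCoord.symm p)) =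
        ((2 * π : ℝ) : ℂ)⁻¹ • A p + (((2 * π : ℝ) : ℂ)⁻¹ * I) • B p := by
    rintro ⟨r, θ⟩ ⟨hr, -⟩
    have hr0 : (r : ℂ) ≠ 0 := by exact_mod_cast ne_of_gt hr
    have hp : Complex.polarCoord.symm (r, θ) = r * e θ := Complex.polarCoord_symm_apply _
    have hpi : (π : ℂ) ≠ 0 := by exact_mod_cast Real.pi_ne_zero
    have h1 : e θ = Real.cos θ • (1 : ℂ) + Real.sin θ • I := by simp [e]
    have h2 : I * e θ = (-Real.sin θ) • (1 : ℂ) + Real.cos θ • I := by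
      simp only [e, real_smul]
      push_cast
      linear_combination (Complex.sin θ) * Complex.I_sq
    have hinv : (e θ)⁻¹ = Real.cos θ - Real.sin θ * I := by
      refine inv_eq_of_mul_eq_one_right ?_
      have := Complex.sin_sq_add_cos_sq (θ : ℂ)
      simp only [e]
      push_cast
      linear_combination this - (Complex.sin θ)^2 * Complex.I_sq
    simp only [A, B, hp]
    rw [h2]
    conv_rhs => rw [show fderiv ℝ f (z - ↑r * e θ) (e θ) =
      fderiv ℝ f (z - ↑r * e θ) (Real.cos θ • (1 : ℂ) + Real.sin θ • I) by rw [← h1]]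
    simp only [map_add, map_smul, delMinus, firstOrder, cauchyKernel, mul_inv, hinv]
    set X := fderiv ℝ f (z - ↑r * e θ) 1
    set Y := fderiv ℝ f (z - ↑r * e θ) I
    have hs : ∀ (a : ℝ) (x : E), a • x = (a : ℂ) • x := fun a x => (Complex.coe_smul a x).symm
    simp only [hs, smul_add, smul_smul]
    have hcomb : ∀ a b c d : ℂ, ∀ x y : E, a = c → b = d → a • x + b • y = c • x + d • y := by
      rintro a b c d x y rfl rfl; rfl
    rw [show ∀ a b c d : ℂ, a • X + b • Y + (c • X + d • Y) = (a + c) • X + (b + d) • Y by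
      intros; module]
    refine hcomb _ _ _ _ _ _ ?_ ?_
    · push_cast
      field_simp
      ring
    · push_cast
      field_simp
      linear_combination (-Complex.sin θ) * Complex.I_sq
  have hset : polarCoord.target = S := rfl
  rw [hset, setIntegral_congr_fun (measurableSet_Ioi.prod measurableSet_Ioo) hcongr, integral_add,
    integral_smul, integral_smul, hIA, hIB, smul_zero, add_zero, ← Complex.coe_smul, smul_smul,
    inv_mul_cancel₀, one_smul]
  · exact_mod_cast (by positivity : (2 * π : ℝ) ≠ 0)
  · exact hAint.smul _
  · exact hBint.smul _

theorem exists_setIntegral_cauchyKernel_lt {ε : ℝ} (hε : 0 < ε) :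
    ∃ R > 0, ∀ c : ℂ, ∫ ζ in Metric.closedBall c R, ‖cauchyKernel ζ‖ < ε := by
  let k : ℂ → ℝ := (Metric.ball 0 1).indicator fun ζ => ‖cauchyKernel ζ‖
  have hk : Integrable k := by
    rw [integrable_indicator_iff measurableSet_ball]
    exact ((locallyIntegrable_cauchyKernel.integrableOn_isCompact
      (isCompact_closedBall 0 1)).mono_set Metric.ball_subset_closedBall).norm
  have hkle : ∀ ζ, ‖cauchyKernel ζ‖ ≤ k ζ + Real.pi⁻¹ := by
    intro ζ
    by_cases h : ζ ∈ Metric.ball (0 : ℂ) 1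
    · simp only [k, Set.indicator_of_mem h]
      have := Real.pi_pos
      have : 0 < Real.pi⁻¹ := by positivity
      linarith
    · simp only [k, Set.indicator_of_notMem h, zero_add, cauchyKernel, norm_mul, norm_inv]
      have h1 : 1 ≤ ‖ζ‖ := by simpa using h
      have h2 : ‖ζ‖⁻¹ ≤ 1 := inv_le_one_of_one_le₀ h1
      simpa [abs_of_pos Real.pi_pos] using
        mul_le_of_le_one_right (by positivity : 0 ≤ Real.pi⁻¹) h2
  have h1 : ∀ᶠ v in 𝓝 (0 : ENNReal), ∀ s : Set ℂ, volume s = v → ∫ ζ in s, k ζ < ε / 2 := by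
    have := hk.tendsto_setIntegral_nhds_zero (l := Filter.comap (volume : Set ℂ → ENNReal) (𝓝 0))
      (s := id) Filter.tendsto_comap
    exact Filter.eventually_comap.1 (this.eventually_lt_const (half_pos hε))
  have hvol : ∀ (c : ℂ) (R : ℝ), volume (Metric.closedBall c R) =
      ENNReal.ofReal R ^ 2 * NNReal.pi :=
    Complex.volume_closedBall
  have hlim : Filter.Tendsto (fun R : ℝ => ENNReal.ofReal R ^ 2 * (NNReal.pi : ENNReal)) (𝓝 0)
      (𝓝 0) := by
    have h2 : Filter.Tendsto (fun R : ℝ => ENNReal.ofReal R ^ 2) (𝓝 0) (𝓝 0) := by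
      have := ((ENNReal.continuous_pow 2).comp ENNReal.continuous_ofReal).tendsto 0
      simpa [Function.comp_def] using this
    simpa using ENNReal.Tendsto.mul_const h2 (Or.inr ENNReal.coe_ne_top)
  have h3 : ∀ᶠ R : ℝ in 𝓝 0, Real.pi⁻¹ * (R ^ 2 * Real.pi) < ε / 2 := by
    have : Continuous fun R : ℝ => Real.pi⁻¹ * (R ^ 2 * Real.pi) := by fun_prop
    exact this.continuousAt.eventually_lt_const (by simpa using half_pos hε)
  obtain ⟨R, ⟨hR1, hR2⟩, hR0⟩ := (((hlim.eventually h1).and h3).filter_mono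
    (nhdsWithin_le_nhds (s := Set.Ioi 0))).and self_mem_nhdsWithin |>.exists
  refine ⟨R, hR0, fun c => ?_⟩
  have hfin : IsFiniteMeasure (volume.restrict (Metric.closedBall c R)) :=
    ⟨by
      rw [Measure.restrict_apply_univ]
      exact (isCompact_closedBall c R).measure_lt_top⟩
  calc ∫ ζ in Metric.closedBall c R, ‖cauchyKernel ζ‖
      ≤ ∫ ζ in Metric.closedBall c R, (k ζ + Real.pi⁻¹) := by
        refine setIntegral_mono (locallyIntegrable_cauchyKernel.integrableOn_isCompact
          (isCompact_closedBall c R)).norm ?_ hkle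
        exact hk.integrableOn.add (integrable_const _)
    _ = (∫ ζ in Metric.closedBall c R, k ζ) + Real.pi⁻¹ * (R ^ 2 * Real.pi) := by
        rw [integral_add hk.integrableOn (integrable_const _), setIntegral_const, measureReal_def,
          hvol, smul_eq_mul]
        have : (ENNReal.ofReal R ^ 2 * (NNReal.pi : ENNReal)).toReal = R ^ 2 * Real.pi := by
          simp [ENNReal.toReal_mul, ENNReal.toReal_ofReal (le_of_lt hR0)]
        rw [this]
        ring
    _ < ε := by
        have := hR1 _ (hvol c R)
        linarith

/-- The Cauchy transform is small on functions supported in a small disc. -/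
theorem exists_norm_cauchyTransform_le {ε : ℝ} (hε : 0 < ε) (z₀ : ℂ) :
    ∃ R > 0, ∀ (f : ℂ → E) (C : ℝ), Continuous f →
      (∀ w, w ∉ Metric.closedBall z₀ R → f w = 0) → (∀ w, ‖f w‖ ≤ C) →
      ∀ z, ‖cauchyTransform f z‖ ≤ ε * C := by
  obtain ⟨R, hR, hk⟩ := exists_setIntegral_cauchyKernel_lt hε
  refine ⟨R, hR, fun f C hf h0 hC z => ?_⟩
  have hC0 : 0 ≤ C := (norm_nonneg _).trans (hC 0)
  have hzero : ∀ ζ, ζ ∉ Metric.closedBall (z - z₀) R → cauchyKernel ζ • f (z - ζ) = 0 := by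
    intro ζ hζ
    rw [h0 (z - ζ), smul_zero]
    contrapose! hζ
    rw [Metric.mem_closedBall, dist_eq_norm] at hζ ⊢
    rwa [show ζ - (z - z₀) = -(z - ζ - z₀) by ring, norm_neg]
  have hki := (locallyIntegrable_cauchyKernel.integrableOn_isCompact
    (isCompact_closedBall (z - z₀) R)).norm
  rw [cauchyTransform_apply, ← setIntegral_eq_integral_of_forall_compl_eq_zero hzero]
  calc ‖∫ ζ in Metric.closedBall (z - z₀) R, cauchyKernel ζ • f (z - ζ)‖
      ≤ ∫ ζ in Metric.closedBall (z - z₀) R, ‖cauchyKernel ζ‖ * C := by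
        refine norm_integral_le_of_norm_le (hki.mul_const C) ?_
        refine Filter.Eventually.of_forall fun ζ => ?_
        rw [norm_smul]
        exact mul_le_mul_of_nonneg_left (hC _) (norm_nonneg _)
    _ = (∫ ζ in Metric.closedBall (z - z₀) R, ‖cauchyKernel ζ‖) * C := integral_mul_const _ _
    _ ≤ ε * C := mul_le_mul_of_nonneg_right (hk _).le hC0

/-- Dominated convergence for the Cauchy transform. -/
theorem tendsto_cauchyTransform {ι : Type*} {l : Filter ι} [l.IsCountablyGenerated]
    {f : ι → ℂ → E} {g : ℂ → E} {K : Set ℂ} (hK : IsCompact K) {C : ℝ}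
    (hf : ∀ᶠ n in l, Continuous (f n)) (h0 : ∀ᶠ n in l, ∀ w, w ∉ K → f n w = 0)
    (hC : ∀ᶠ n in l, ∀ w, ‖f n w‖ ≤ C)
    (hlim : ∀ w, Filter.Tendsto (fun n => f n w) l (𝓝 (g w))) (z : ℂ) :
    Filter.Tendsto (fun n => cauchyTransform (f n) z) l (𝓝 (cauchyTransform g z)) := by
  simp only [cauchyTransform_apply]
  let K' : Set ℂ := (fun w => z - w) '' K
  have hK' : IsCompact K' := hK.image (by fun_prop)
  refine tendsto_integral_filter_of_dominated_convergence
    (K'.indicator fun ζ => ‖cauchyKernel ζ‖ * C) ?_ ?_ ?_ ?_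
  · filter_upwards [hf] with n hn
    exact (measurable_cauchyKernel.aestronglyMeasurable).smul
      (hn.comp (by fun_prop : Continuous fun ζ => z - ζ)).aestronglyMeasurable
  · filter_upwards [h0, hC] with n hn hCn
    refine Filter.Eventually.of_forall fun ζ => ?_
    by_cases h : ζ ∈ K'
    · rw [Set.indicator_of_mem h, norm_smul]
      exact mul_le_mul_of_nonneg_left (hCn _) (norm_nonneg _)
    · rw [Set.indicator_of_notMem h, hn, smul_zero, norm_zero]
      exact fun h1 => h ⟨z - ζ, h1, by ring⟩
  · rw [integrable_indicator_iff hK'.measurableSet]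
    exact (locallyIntegrable_cauchyKernel.integrableOn_isCompact hK').norm.mul_const C
  · exact Filter.Eventually.of_forall fun ζ => (hlim _).const_smul _

/-- The Cauchy transform of `f` is smooth where `f` vanishes: there the singularity of the kernel
can be cut off. -/
theorem contDiffAt_cauchyTransform [CompleteSpace E] {f : ℂ → E} (hf : Continuous f)
    (hc : HasCompactSupport f) {z₀ : ℂ} (h0 : ∀ᶠ z in 𝓝 z₀, f z = 0) :
    ContDiffAt ℝ ∞ (cauchyTransform f) z₀ := by
  obtain ⟨δ, hδ, h0⟩ := Metric.eventually_nhds_iff.1 h0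
  obtain ⟨R, hRpos, hR⟩ := hc.isCompact.isBounded.exists_pos_norm_le
  let ψ : ContDiffBump (0 : ℂ) := ⟨δ / 4, δ / 2, by positivity, by linarith⟩
  let θ : ContDiffBump (0 : ℂ) :=
    ⟨R + ‖z₀‖ + δ, R + ‖z₀‖ + δ + 1, by positivity, by linarith⟩
  let k : ℂ → ℂ := fun ζ => ((θ ζ * (1 - ψ ζ) : ℝ) : ℂ) * cauchyKernel ζ
  have hk : ContDiff ℝ ∞ k := by
    rw [contDiff_iff_contDiffAt]
    intro ζ
    by_cases h : ζ = 0
    · have h1 : k =ᶠ[𝓝 ζ] fun _ => 0 := by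
        have : ∀ᶠ w in 𝓝 (0 : ℂ), ψ w = 1 := ψ.eventuallyEq_one
        rw [h]
        filter_upwards [this] with w hw
        simp [k, hw]
      exact contDiffAt_const.congr_of_eventuallyEq h1
    · refine ContDiffAt.mul ?_ ?_
      · refine Complex.ofRealCLM.contDiff.contDiffAt.comp ζ ?_
        exact (θ.contDiff.mul (contDiff_const.sub ψ.contDiff)).contDiffAt
      · exact contDiffAt_const.mul (contDiffAt_inv ℝ h)
  have hkc : HasCompactSupport k := by
    refine θ.hasCompactSupport.mono' fun ζ hζ => subset_tsupport _ ?_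
    contrapose! hζ
    simp only [Function.mem_support, not_not] at hζ
    simp [k, hζ]
  have hconv : ContDiff ℝ ∞ (k ⋆[ContinuousLinearMap.lsmul ℝ ℂ] f) :=
    hkc.contDiff_convolution_left _ hk hf.locallyIntegrable
  refine hconv.contDiffAt.congr_of_eventuallyEq ?_
  filter_upwards [Metric.ball_mem_nhds z₀ (half_pos hδ)] with z hz
  rw [cauchyTransform_apply, convolution_def]
  congr 1
  ext ζ
  rw [Metric.mem_ball, dist_eq_norm] at hz
  by_cases hfz : f (z - ζ) = 0
  · simp [hfz]
  have h1 : δ ≤ ‖z - ζ - z₀‖ := by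
    by_contra h
    exact hfz (h0 (by rw [dist_eq_norm]; exact not_le.1 h))
  have h2 : ‖z - ζ‖ ≤ R := hR _ (subset_tsupport _ hfz)
  have h3 : δ / 2 ≤ ‖ζ‖ := by
    have : ‖z - ζ - z₀‖ ≤ ‖z - z₀‖ + ‖ζ‖ := by
      rw [show z - ζ - z₀ = (z - z₀) - ζ by ring]; exact norm_sub_le _ _
    linarith
  have h4 : ‖ζ‖ ≤ R + ‖z₀‖ + δ := by
    have e1 : ‖ζ‖ ≤ ‖z - z₀‖ + ‖z₀‖ + ‖z - ζ‖ := by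
      calc ‖ζ‖ = ‖(z - z₀) + z₀ - (z - ζ)‖ := by congr 1; ring
        _ ≤ _ := (norm_sub_le _ _).trans (add_le_add_left (norm_add_le _ _) _)
    linarith
  have h5 : ψ ζ = 0 := ψ.zero_of_le_dist (by simpa using h3)
  have h6 : θ ζ = 1 := θ.one_of_mem_closedBall (by simpa using h4)
  simp [k, h5, h6]

end Transform

/-! ### First-order operators with constant coefficients -/

section Calculus

variable {E F G : Type*} [NormedAddCommGroup E] [NormedSpace ℂ E] [NormedAddCommGroup F]
  [NormedSpace ℂ F] [NormedAddCommGroup G] [NormedSpace ℂ G] {c d : ℂ}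

theorem firstOrder_add {f g : ℂ → E} {z : ℂ} (hf : DifferentiableAt ℝ f z)
    (hg : DifferentiableAt ℝ g z) :
    firstOrder c d (fun w => f w + g w) z = firstOrder c d f z + firstOrder c d g z := by
  simp only [firstOrder, fderiv_fun_add hf hg, add_apply]
  module

theorem firstOrder_sub {f g : ℂ → E} {z : ℂ} (hf : DifferentiableAt ℝ f z)
    (hg : DifferentiableAt ℝ g z) :
    firstOrder c d (fun w => f w - g w) z = firstOrder c d f z - firstOrder c d g z := by
  simp only [firstOrder, fderiv_fun_sub hf hg, sub_apply]
  module

theorem firstOrder_clm_comp (A : E →L[ℂ] F) {f : ℂ → E} {z : ℂ} (hf : DifferentiableAt ℝ f z) :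
    firstOrder c d (fun w => A (f w)) z = A (firstOrder c d f z) := by
  have h : HasFDerivAt (fun w => A (f w)) ((A.restrictScalars ℝ).comp (fderiv ℝ f z)) z :=
    (A.restrictScalars ℝ).hasFDerivAt.comp z hf.hasFDerivAt
  simp [firstOrder, h.fderiv]

theorem _root_.Filter.EventuallyEq.firstOrder_eq {f g : ℂ → E} {z : ℂ} (h : f =ᶠ[𝓝 z] g) :
    firstOrder c d f z = firstOrder c d g z := by
  simp only [firstOrder, h.fderiv_eq]

/-- The Leibniz rule, for a complex bilinear product. -/
theorem firstOrder_bilinear (B : E →L[ℂ] F →L[ℂ] G) {f : ℂ → E} {g : ℂ → F} {z : ℂ}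
    (hf : DifferentiableAt ℝ f z) (hg : DifferentiableAt ℝ g z) :
    firstOrder c d (fun w => B (f w) (g w)) z =
      B (firstOrder c d f z) (g z) + B (f z) (firstOrder c d g z) := by
  have h := ((B.bilinearRestrictScalars ℝ).isBoundedBilinearMap.hasFDerivAt (f z, g z)).comp z
    (hf.hasFDerivAt.prodMk hg.hasFDerivAt)
  have h' : HasFDerivAt (fun w => B (f w) (g w)) _ z := h
  simp only [firstOrder, h'.fderiv]
  simp
  module

theorem contDiff_firstOrder {n m : WithTop ℕ∞} {f : ℂ → E} (hf : ContDiff ℝ n f) (h : m + 1 ≤ n) :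
    ContDiff ℝ m (firstOrder c d f) := by
  have h1 := hf.fderiv_right h
  have h2 : ∀ v : ℂ, ContDiff ℝ m fun z => fderiv ℝ f z v := fun v => h1.clm_apply contDiff_const
  exact ((h2 1).const_smul c).add ((h2 I).const_smul d)

/-- First-order operators with constant coefficients commute on functions of class `C²`. -/
theorem firstOrder_comm {c' d' : ℂ} {f : ℂ → E} {z : ℂ} (hf : ContDiffAt ℝ 2 f z) :
    firstOrder c d (firstOrder c' d' f) z = firstOrder c' d' (firstOrder c d f) z := by
  have h1 : DifferentiableAt ℝ (fderiv ℝ f) z :=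
    (hf.fderiv_right (m := 1) (by norm_num)).differentiableAt one_ne_zero
  have hsymm : IsSymmSndFDerivAt ℝ f z := hf.isSymmSndFDerivAt (by simp)
  have h2 : ∀ a b v : ℂ, fderiv ℝ (firstOrder a b f) z v =
      a • fderiv ℝ (fderiv ℝ f) z v 1 + b • fderiv ℝ (fderiv ℝ f) z v I := by
    intro a b v
    have h3 : ∀ u : ℂ, HasFDerivAt (fun w => fderiv ℝ f w u)
        ((fderiv ℝ (fderiv ℝ f) z).flip u) z := fun u => by
      have := h1.hasFDerivAt.clm_apply (hasFDerivAt_const u z)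
      simpa using this
    have h4 : HasFDerivAt (firstOrder a b f) _ z :=
      ((h3 1).const_smul a).add ((h3 I).const_smul b)
    rw [h4.fderiv]
    simp
  rw [firstOrder, firstOrder, h2, h2, h2, h2, hsymm.eq I 1]
  module

theorem contDiff_succ_of_firstOrder {n : ℕ} {f : ℂ → E} (hf : Differentiable ℝ f)
    (h1 : ContDiff ℝ n (delPlus f)) (h2 : ContDiff ℝ n (delMinus f)) :
    ContDiff ℝ (n + 1 : ℕ) f := by
  have hI : ∀ z, fderiv ℝ f z I = I • (delPlus f z - delMinus f z) := fun z => by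
    simp only [firstOrder, smul_sub, smul_add, smul_smul]
    rw [show I * -(I / 2) = 1 / 2 by linear_combination (-1 / 2) * I_sq,
      show I * (I / 2) = -(1 / 2) by linear_combination (1 / 2) * I_sq]
    module
  have h3 : ∀ z, fderiv ℝ f z 1 = delPlus f z + delMinus f z := fun z => by
    simp only [firstOrder]; module
  have h4 : ∀ z, fderiv ℝ f z = reCLM.smulRight (delPlus f z + delMinus f z) +
      imCLM.smulRight (I • (delPlus f z - delMinus f z)) := fun z => by
    ext v
    conv_lhs => rw [show v = v.re • (1 : ℂ) + v.im • I by simp [Complex.re_add_im]]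
    rw [map_add, map_smul, map_smul, hI, h3]
    simp
  push_cast
  rw [contDiff_succ_iff_fderiv]
  refine ⟨hf, by simp, ?_⟩
  rw [funext h4]
  have hs : ∀ (l : ℂ →L[ℝ] ℝ) (g : ℂ → E), ContDiff ℝ n g →
      ContDiff ℝ n fun z => l.smulRight (g z) := fun l g hg =>
    (ContinuousLinearMap.smulRightL ℝ ℂ E l).contDiff.comp hg
  exact (hs _ _ (h1.add h2)).add (hs _ _ ((h1.sub h2).const_smul I))

end Calculus

/-! ### Gauges -/

section Gauge

variable {𝒜 : Type*} [NormedRing 𝒜] [NormedAlgebra ℂ 𝒜] [CompleteSpace 𝒜]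

/-- Local solvability of `∂₋g = -g L` by an invertible `g`. With `L` cut off to a small disc, the
series `1 + T M + T (T M · M) + ⋯`, where `M = -χ L` and `T` is the Cauchy transform, converges in
`C¹` to a function close to `1`: each step gains a small factor in the supremum norm, and
differentiation commutes with `T`. -/
theorem exists_gauge {L : ℂ → 𝒜} (hL : ContDiff ℝ 1 L) (z₀ : ℂ) :
    ∃ (g : ℂ → 𝒜) (χ : ℂ → ℂ), ContDiff ℝ 1 g ∧ ContDiff ℝ ∞ χ ∧ HasCompactSupport χ ∧
      (∀ᶠ z in 𝓝 z₀, χ z = 1) ∧ (∀ z, IsUnit (g z)) ∧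
      ∀ z, delMinus g z = -(χ z • (g z * L z)) := by
  obtain ⟨B, hB⟩ := (isCompact_closedBall z₀ 1).exists_bound_of_continuousOn
    hL.continuous.continuousOn
  have hB0 : 0 ≤ B := (norm_nonneg _).trans (hB z₀ (by simp))
  let C : ℝ := ‖(1 : 𝒜)‖
  have hC0 : 0 ≤ C := norm_nonneg _
  let q : ℝ := 1 / (4 * (C + 1))
  have hq0 : 0 < q := by positivity
  have hq1 : q ≤ 1 / 4 := by
    apply one_div_le_one_div_of_le <;> linarith
  let ε : ℝ := q / (B + 1)
  have hε0 : 0 < ε := by positivity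
  have hεB : ε * B ≤ q := by
    have : q = ε * (B + 1) := by simp only [ε]; field_simp
    nlinarith
  obtain ⟨R, hR0, hT⟩ := exists_norm_cauchyTransform_le (E := 𝒜) hε0 z₀
  let b : ContDiffBump z₀ := ⟨min R 1 / 2, min R 1, by positivity, by
    have : 0 < min R 1 := by positivity
    linarith⟩
  let χ : ℂ → ℂ := fun z => (b z : ℂ)
  have hχ : ContDiff ℝ ∞ χ := Complex.ofRealCLM.contDiff.comp b.contDiff
  have hχc : HasCompactSupport χ :=
    b.hasCompactSupport.comp_left (g := fun x : ℝ => (x : ℂ)) (by simp)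
  have hχ1 : ∀ᶠ z in 𝓝 z₀, χ z = 1 := by
    filter_upwards [b.eventuallyEq_one] with z hz
    simp [χ, hz]
  have hχ0 : ∀ z, z ∉ Metric.closedBall z₀ (min R 1) → χ z = 0 := by
    intro z hz
    simp only [χ]
    rw [b.zero_of_le_dist (by simpa using (not_le.1 hz).le)]
    simp
  let M : ℂ → 𝒜 := fun z => -(χ z • L z)
  have hM : ContDiff ℝ 1 M := ((hχ.of_le (by exact_mod_cast le_top)).smul hL).neg
  have hM0 : ∀ z, z ∉ Metric.closedBall z₀ (min R 1) → M z = 0 := fun z hz => by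
    simp [M, hχ0 z hz]
  have hMc : HasCompactSupport M :=
    HasCompactSupport.intro (isCompact_closedBall z₀ (min R 1)) hM0
  have hMB : ∀ z, ‖M z‖ ≤ B := by
    intro z
    by_cases hz : z ∈ Metric.closedBall z₀ (min R 1)
    · have h1 : ‖χ z‖ ≤ 1 := by
        simp only [χ, Complex.norm_real, Real.norm_eq_abs, abs_of_nonneg b.nonneg]
        exact b.le_one
      have h2 := hB z (Metric.closedBall_subset_closedBall (min_le_right _ _) hz)
      rw [norm_neg, norm_smul]
      calc ‖χ z‖ * ‖L z‖ ≤ 1 * B := mul_le_mul h1 h2 (norm_nonneg _) zero_le_one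
        _ = B := one_mul B
    · rw [hM0 z hz, norm_zero]; exact hB0
  obtain ⟨B', hB'⟩ := (hMc.fderiv ℝ).exists_bound_of_continuous (hM.continuous_fderiv one_ne_zero)
  have hB'0 : 0 ≤ B' := (norm_nonneg _).trans (hB' z₀)
  let t : ℕ → ℂ → 𝒜 := fun n =>
    Nat.rec (fun _ => 1) (fun _ s => cauchyTransform fun w => s w * M w) n
  have ht0 : t 0 = fun _ => 1 := rfl
  have htS : ∀ n, t (n + 1) = cauchyTransform fun w => t n w * M w := fun n => rfl
  have hsupp : ∀ s : ℂ → 𝒜, HasCompactSupport fun w => s w * M w := fun s => hMc.mul_left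
  have htC : ∀ n, ContDiff ℝ 1 (t n) := by
    intro n
    induction n with
    | zero => exact contDiff_const
    | succ n ih => exact contDiff_cauchyTransform (n := 1) (ih.mul hM) (hsupp _)
  have hR' : ∀ z, z ∉ Metric.closedBall z₀ R → M z = 0 := fun z hz =>
    hM0 z fun h => hz (Metric.closedBall_subset_closedBall (min_le_left _ _) h)
  have htb : ∀ n z, ‖t n z‖ ≤ C * q ^ n := by
    intro n
    induction n with
    | zero => intro z; simp [ht0, C]
    | succ n ih =>
      intro z
      rw [htS]
      have h1 := hT (fun w => t n w * M w) (C * q ^ n * B) ((htC n).mul hM).continuous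
        (fun w hw => by simp [hR' w hw])
        (fun w => (norm_mul_le _ _).trans (mul_le_mul (ih w) (hMB w) (norm_nonneg _)
          (by positivity))) z
      calc _ ≤ ε * (C * q ^ n * B) := h1
        _ = C * q ^ n * (ε * B) := by ring
        _ ≤ C * q ^ n * q := by gcongr
        _ = _ := by ring
  let K : ℝ := ε * B' * C / q
  have hK0 : 0 ≤ K := by positivity
  have htd : ∀ n z, ‖fderiv ℝ (t n) z‖ ≤ K * (n * q ^ n) := by
    intro n
    induction n with
    | zero => intro z; simp [ht0]
    | succ n ih =>
      intro z
      refine ContinuousLinearMap.opNorm_le_bound _ (by positivity) fun v => ?_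
      have hprod : ContDiff ℝ 1 fun w => t n w * M w := (htC n).mul hM
      rw [htS, fderiv_cauchyTransform hprod (hsupp _)]
      have hder : ∀ w, fderiv ℝ (fun w => t n w * M w) w v =
          t n w * fderiv ℝ M w v + fderiv ℝ (t n) w v * M w := fun w => by
        rw [fderiv_fun_mul' ((htC n).differentiable one_ne_zero w)
          (hM.differentiable one_ne_zero w)]
        simp
      have h1 := hT (fun w => fderiv ℝ (fun w => t n w * M w) w v)
        ((C * q ^ n * B' + K * (n * q ^ n) * B) * ‖v‖)
        ((hprod.continuous_fderiv one_ne_zero).clm_apply continuous_const)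
        (fun w hw => by
          have h2 : ∀ᶠ y in 𝓝 w, M y = 0 := by
            filter_upwards [Metric.isClosed_closedBall.isOpen_compl.mem_nhds hw] with y hy
            exact hR' y hy
          have h3 : (fun w => t n w * M w) =ᶠ[𝓝 w] fun _ => 0 := by
            filter_upwards [h2] with y hy
            simp [hy]
          rw [h3.fderiv_eq]
          simp)
        (fun w => by
          rw [hder]
          have e1 : ‖t n w * fderiv ℝ M w v‖ ≤ C * q ^ n * (B' * ‖v‖) :=
            (norm_mul_le _ _).trans (mul_le_mul (htb n w)
              ((ContinuousLinearMap.le_opNorm _ _).trans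
                (mul_le_mul_of_nonneg_right (hB' w) (norm_nonneg _))) (norm_nonneg _)
              (by positivity))
          have e2 : ‖fderiv ℝ (t n) w v * M w‖ ≤ K * (n * q ^ n) * ‖v‖ * B :=
            (norm_mul_le _ _).trans (mul_le_mul
              ((ContinuousLinearMap.le_opNorm _ _).trans
                (mul_le_mul_of_nonneg_right (ih w) (norm_nonneg _))) (hMB w) (norm_nonneg _)
              (by positivity))
          calc _ ≤ C * q ^ n * (B' * ‖v‖) + K * (n * q ^ n) * ‖v‖ * B :=
                (norm_add_le _ _).trans (add_le_add e1 e2)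
            _ = _ := by ring) z
      refine h1.trans ?_
      have e3 : ε * B' * C = K * q := by simp only [K]; field_simp
      calc ε * ((C * q ^ n * B' + K * (n * q ^ n) * B) * ‖v‖)
          = ((ε * B' * C) * q ^ n + K * (n * q ^ n) * (ε * B)) * ‖v‖ := by ring
        _ ≤ ((ε * B' * C) * q ^ n + K * (n * q ^ n) * q) * ‖v‖ := by gcongr
        _ = K * (((n + 1 : ℕ) : ℝ) * q ^ (n + 1)) * ‖v‖ := by rw [e3]; push_cast; ring
  have hqn : ‖q‖ < 1 := by rw [Real.norm_of_nonneg hq0.le]; linarith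
  have hs0 : Summable fun n : ℕ => C * q ^ n :=
    (summable_geometric_of_norm_lt_one hqn).mul_left C
  have hs1 : Summable fun n : ℕ => K * (n * q ^ n) := by
    have := summable_pow_mul_geometric_of_norm_lt_one 1 hqn
    simp only [pow_one] at this
    exact this.mul_left K
  let g : ℂ → 𝒜 := fun z => ∑' n, t n z
  have hst : ∀ z, Summable fun n => t n z := fun z => .of_norm_bounded hs0 fun n => htb n z
  have hg : ContDiff ℝ 1 g := by
    refine contDiff_tsum (N := 1)
      (v := fun (k n : ℕ) => if k = 0 then C * q ^ n else K * (n * q ^ n))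
      htC ?_ ?_
    · intro k _
      by_cases hk : k = 0 <;> simp [hk, hs0, hs1]
    · intro k n z hk
      have hk' : k ≤ 1 := by exact_mod_cast hk
      interval_cases k
      · simpa using htb n z
      · simpa [norm_iteratedFDeriv_one] using htd n z
  refine ⟨g, χ, hg, hχ, hχc, hχ1, fun z => ?_, fun z => ?_⟩
  · have h1 : g z = 1 + ∑' n, t (n + 1) z := by
      simp only [g]
      rw [(hst z).tsum_eq_zero_add, ht0]
    have h2 : ‖∑' n, t (n + 1) z‖ < 1 := by
      have h3 : Summable fun n : ℕ => C * q ^ (n + 1) := (summable_nat_add_iff 1).2 hs0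
      have h4 := tsum_of_norm_bounded h3.hasSum fun n => htb (n + 1) z
      refine h4.trans_lt ?_
      have h5 : ∑' n : ℕ, C * q ^ (n + 1) = C * q * (1 - q)⁻¹ := by
        rw [← tsum_geometric_of_norm_lt_one hqn, ← tsum_mul_left]
        congr 1; ext n; ring
      rw [h5, ← div_eq_mul_inv, div_lt_one (by linarith)]
      have h6 : q * (4 * (C + 1)) = 1 := by simp only [q]; field_simp
      nlinarith
    have := (Units.oneSub (-∑' n, t (n + 1) z) (by rwa [norm_neg])).isUnit
    rwa [Units.val_oneSub, sub_neg_eq_add, ← h1] at this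
  · have h1 : ∀ v, fderiv ℝ g z v = ∑' n, fderiv ℝ (t n) z v := fun v => by
      have h2 := fderiv_tsum_apply hs1 (fun n => (htC n).differentiable one_ne_zero) htd
        (x₀ := z) (hst z) z
      simp only [g]
      rw [h2]
      have h3 : Summable fun n => fderiv ℝ (t n) z :=
        .of_norm_bounded hs1 fun n => htd n z
      exact (ContinuousLinearMap.apply ℝ 𝒜 v).map_tsum h3
    have hsv : ∀ v, Summable fun n => fderiv ℝ (t n) z v := fun v => by
      have h3 : Summable fun n => fderiv ℝ (t n) z :=
        .of_norm_bounded hs1 fun n => htd n z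
      exact (ContinuousLinearMap.apply ℝ 𝒜 v).summable h3
    have h2 : delMinus g z = ∑' n, delMinus (t n) z := by
      simp only [firstOrder, h1]
      rw [((hsv 1).const_smul _).tsum_add ((hsv I).const_smul _), (hsv 1).tsum_const_smul,
        (hsv I).tsum_const_smul]
    have h3 : Summable fun n => delMinus (t n) z :=
      ((hsv 1).const_smul _).add ((hsv I).const_smul _)
    have h4 : ∀ n, delMinus (t (n + 1)) z = t n z * M z := fun n => by
      have hp : ContDiff ℝ 1 fun w => t n w * M w := (htC n).mul hM
      rw [htS]
      exact (firstOrder_cauchyTransform hp (hsupp _) z).trans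
        (cauchyTransform_delMinus hp (hsupp _) z)
    rw [h2, h3.tsum_eq_zero_add]
    simp only [h4]
    rw [(hst z).tsum_mul_right]
    simp [ht0, firstOrder, g, M]

end Gauge

/-! ### Regularity and zeros of solutions of `∂₋u = L u` -/

section Regularity

variable {E F : Type*} [NormedAddCommGroup E] [NormedSpace ℂ E] [NormedAddCommGroup F]
  [NormedSpace ℂ F]

theorem exists_norm_slope_le {f : ℂ → E} (hf : ContDiff ℝ 1 f) {K : Set ℂ} (hK : IsCompact K)
    (v : ℂ) : ∃ C, 0 ≤ C ∧ ∀ t : ℝ, |t| ≤ 1 → ∀ w ∈ K, ‖t⁻¹ • (f (w + t • v) - f w)‖ ≤ C := by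
  obtain ⟨R, hR0, hR⟩ := hK.isBounded.exists_pos_norm_le
  obtain ⟨C, hC⟩ := (isCompact_closedBall (0 : ℂ) (R + ‖v‖)).exists_bound_of_continuousOn
    (hf.continuous_fderiv one_ne_zero).continuousOn
  have hC0 : 0 ≤ C := (norm_nonneg _).trans (hC 0 (by simp; positivity))
  refine ⟨C * ‖v‖, by positivity, fun t ht w hw => ?_⟩
  by_cases h0 : t = 0
  · simp only [h0, inv_zero, zero_smul, norm_zero]; positivity
  have hw1 : w ∈ Metric.closedBall (0 : ℂ) (R + ‖v‖) := by
    have := hR w hw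
    simp only [mem_closedBall_zero_iff]
    linarith [norm_nonneg v]
  have htv : ‖t • v‖ = |t| * ‖v‖ := by rw [norm_smul, Real.norm_eq_abs]
  have hw2 : w + t • v ∈ Metric.closedBall (0 : ℂ) (R + ‖v‖) := by
    have := hR w hw
    simp only [mem_closedBall_zero_iff]
    have h1 := norm_add_le w (t • v)
    have h2 : |t| * ‖v‖ ≤ ‖v‖ := mul_le_of_le_one_left (norm_nonneg _) ht
    linarith
  have h3 := (convex_closedBall (0 : ℂ) (R + ‖v‖)).norm_image_sub_le_of_norm_fderiv_le
    (fun x _ => hf.differentiable one_ne_zero x) hC hw1 hw2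
  rw [norm_smul, norm_inv, Real.norm_eq_abs]
  rw [add_sub_cancel_left, htv] at h3
  have ht0 : 0 < |t| := abs_pos.2 h0
  rw [inv_mul_le_iff₀ ht0]
  linarith

theorem tendsto_slope {f : ℂ → E} {z : ℂ} (hf : DifferentiableAt ℝ f z) (v : ℂ) :
    Filter.Tendsto (fun t : ℝ => t⁻¹ • (f (z + t • v) - f z)) (𝓝[≠] 0) (𝓝 (fderiv ℝ f z v)) := by
  have h := hf.hasFDerivAt.hasLineDerivAt v
  simpa [HasLineDerivAt, hasDerivAt_iff_tendsto_slope, slope_fun_def] using! h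

variable [CompleteSpace F]

/-- The Cauchy–Pompeiu formula for `φ · ∂_v a`, although `∂_v a` is only continuous: it is enough
that `∂₋a` be of class `C¹`, as the formula passes to the limit in difference quotients. -/
theorem clm_fderiv_eq_cauchyTransform {φ : ℂ → E →L[ℂ] F} (hφ : ContDiff ℝ 1 φ)
    (hφc : HasCompactSupport φ) {a : ℂ → E} (ha : ContDiff ℝ 1 a)
    (ha' : ContDiff ℝ 1 (delMinus a)) (v z : ℂ) :
    φ z (fderiv ℝ a z v) = cauchyTransform (fun w => delMinus φ w (fderiv ℝ a w v) +
      φ w (fderiv ℝ (delMinus a) w v)) z := by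
  let s : ℝ → ℂ → E := fun t w => t⁻¹ • (a (w + t • v) - a w)
  let r : ℝ → ℂ → E := fun t w => t⁻¹ • (delMinus a (w + t • v) - delMinus a w)
  have hshift : ∀ t : ℝ, ContDiff ℝ 1 fun w => a (w + t • v) := fun t =>
    ha.comp (contDiff_id.add contDiff_const)
  have hs : ∀ t, ContDiff ℝ 1 (s t) := fun t => ((hshift t).sub ha).const_smul _
  have hr : ∀ t, Continuous (r t) := fun t =>
    ((ha'.continuous.comp (continuous_id.add continuous_const)).sub ha'.continuous).const_smul _
  have hsr : ∀ t w, delMinus (s t) w = r t w := by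
    intro t w
    have h1 : s t = fun w => (t⁻¹ : ℂ) • (a (w + t • v) - a w) := by
      ext w; simp only [s, ← Complex.coe_smul, Complex.ofReal_inv]
    have h2 : firstOrder (1 / 2) (I / 2) (fun w => a (w + t • v)) w = delMinus a (w + t • v) := by
      simp only [firstOrder, fderiv_comp_add_right]
    rw [h1]
    have h3 := firstOrder_clm_comp (c := 1 / 2) (d := I / 2)
      ((t⁻¹ : ℂ) • ContinuousLinearMap.id ℂ E) (z := w)
      (((hshift t).sub ha).differentiable one_ne_zero w)
    have h4 := firstOrder_sub (c := 1 / 2) (d := I / 2)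
      ((hshift t).differentiable one_ne_zero w) (ha.differentiable one_ne_zero w)
    simp only [smul_apply, ContinuousLinearMap.id_apply] at h3
    refine h3.trans ?_
    simp only [r]
    rw [h4, h2, ← Complex.ofReal_inv]
    exact Complex.coe_smul _ _
  have hdφ : Continuous (delMinus φ) := continuous_firstOrder hφ
  have hdφc : HasCompactSupport (delMinus φ) := hφc.firstOrder
  have hident : ∀ t, φ z (s t z) =
      cauchyTransform (fun w => delMinus φ w (s t w) + φ w (r t w)) z := by
    intro t
    have h1 : ContDiff ℝ 1 fun w => φ w (s t w) := by
      have := (((ContinuousLinearMap.apply ℂ F).flip).bilinearRestrictScalars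
        ℝ).isBoundedBilinearMap.contDiff.comp (hφ.prodMk (hs t))
      exact this
    have h2 : HasCompactSupport fun w => φ w (s t w) := by
      refine hφc.mono fun w hw => ?_
      contrapose! hw
      simp only [Function.mem_support, not_not] at hw
      simp [hw]
    rw [← cauchyTransform_delMinus h1 h2 z]
    congr 1
    ext w
    have := firstOrder_bilinear (c := 1 / 2) (d := I / 2)
      (ContinuousLinearMap.apply ℂ F).flip (hφ.differentiable one_ne_zero w)
      ((hs t).differentiable one_ne_zero w)
    simp only [ContinuousLinearMap.flip_apply, ContinuousLinearMap.apply_apply] at this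
    rw [delMinus, this]
    congr 2
    exact hsr t w
  have hlim1 : Filter.Tendsto (fun t => φ z (s t z)) (𝓝[≠] 0) (𝓝 (φ z (fderiv ℝ a z v))) :=
    ((φ z).continuous.tendsto _).comp (tendsto_slope (ha.differentiable one_ne_zero z) v)
  obtain ⟨C₁, hC₁, hs₁⟩ := exists_norm_slope_le ha hφc.isCompact v
  obtain ⟨C₂, hC₂, hr₁⟩ := exists_norm_slope_le ha' hφc.isCompact v
  obtain ⟨D₁, hD₁⟩ := hdφc.exists_bound_of_continuous hdφ
  obtain ⟨D₂, hD₂⟩ := hφc.exists_bound_of_continuous hφ.continuous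
  have hD₁0 : 0 ≤ D₁ := (norm_nonneg _).trans (hD₁ 0)
  have hD₂0 : 0 ≤ D₂ := (norm_nonneg _).trans (hD₂ 0)
  have hzero : ∀ w, w ∉ tsupport φ → φ w = 0 ∧ delMinus φ w = 0 := fun w hw => by
    refine ⟨image_eq_zero_of_notMem_tsupport hw, ?_⟩
    have : fderiv ℝ φ w = 0 := by_contra fun h => hw (support_fderiv_subset ℝ h)
    simp [firstOrder, this]
  have hsmall : ∀ᶠ t : ℝ in 𝓝[≠] 0, |t| ≤ 1 := by
    refine Filter.Eventually.filter_mono nhdsWithin_le_nhds ?_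
    filter_upwards [Metric.ball_mem_nhds (0 : ℝ) one_pos] with t ht
    simpa using (mem_ball_zero_iff.1 ht).le
  have hlim2 := tendsto_cauchyTransform (l := 𝓝[≠] (0 : ℝ))
    (f := fun t w => delMinus φ w (s t w) + φ w (r t w))
    (g := fun w => delMinus φ w (fderiv ℝ a w v) + φ w (fderiv ℝ (delMinus a) w v))
    hφc.isCompact (C := D₁ * C₁ + D₂ * C₂)
    (Filter.Eventually.of_forall fun t =>
      (hdφ.clm_apply (hs t).continuous).add (hφ.continuous.clm_apply (hr t)))
    (Filter.Eventually.of_forall fun t w hw => by simp [hzero w hw])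
    (by
      filter_upwards [hsmall] with t ht w
      by_cases hw : w ∈ tsupport φ
      · refine (norm_add_le _ _).trans (add_le_add ?_ ?_)
        · exact (ContinuousLinearMap.le_opNorm _ _).trans
            (mul_le_mul (hD₁ w) (hs₁ t ht w hw) (norm_nonneg _) hD₁0)
        · exact (ContinuousLinearMap.le_opNorm _ _).trans
            (mul_le_mul (hD₂ w) (hr₁ t ht w hw) (norm_nonneg _) hD₂0)
      · simp only [hzero w hw]
        simp
        positivity)
    (fun w => ((((delMinus φ w).continuous.tendsto _).comp
      (tendsto_slope (ha.differentiable one_ne_zero w) v))).add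
      ((((φ w).continuous.tendsto _).comp
      (tendsto_slope (ha'.differentiable one_ne_zero w) v)))) z
  simp only [← hident] at hlim2
  exact tendsto_nhds_unique hlim1 hlim2

theorem clm_delPlus_eq_cauchyTransform {φ : ℂ → E →L[ℂ] F} (hφ : ContDiff ℝ 1 φ)
    (hφc : HasCompactSupport φ) {a : ℂ → E} (ha : ContDiff ℝ 1 a)
    (ha' : ContDiff ℝ 1 (delMinus a)) (z : ℂ) :
    φ z (delPlus a z) = cauchyTransform (fun w => delMinus φ w (delPlus a w) +
      φ w (delPlus (delMinus a) w)) z := by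
  have h : ∀ v, Continuous fun w => delMinus φ w (fderiv ℝ a w v) +
      φ w (fderiv ℝ (delMinus a) w v) := fun v =>
    ((continuous_firstOrder hφ).clm_apply ((ha.continuous_fderiv one_ne_zero).clm_apply
      continuous_const)).add (hφ.continuous.clm_apply ((ha'.continuous_fderiv
        one_ne_zero).clm_apply continuous_const))
  have hc : ∀ v, HasCompactSupport fun w => delMinus φ w (fderiv ℝ a w v) +
      φ w (fderiv ℝ (delMinus a) w v) := fun v => by
    refine HasCompactSupport.intro hφc.isCompact fun w hw => ?_
    have h1 : fderiv ℝ φ w = 0 := by_contra fun h => hw (support_fderiv_subset ℝ h)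
    simp [firstOrder, h1, image_eq_zero_of_notMem_tsupport hw]
  conv_lhs => rw [delPlus, firstOrder, map_add, map_smul, map_smul,
    clm_fderiv_eq_cauchyTransform hφ hφc ha ha', clm_fderiv_eq_cauchyTransform hφ hφc ha ha',
    ← cauchyTransform_smul, ← cauchyTransform_smul]
  rw [← cauchyTransform_add]
  · congr 1
    ext w
    simp only [delPlus]
    conv_rhs => rw [firstOrder, firstOrder]
    simp only [map_add, map_smul]
    module
  · exact (h 1).const_smul _
  · exact (hc 1).smul_left (f := fun _ => (1 / 2 : ℂ))
  · exact (h I).const_smul _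
  · exact (hc I).smul_left (f := fun _ => (-(I / 2) : ℂ))

variable [CompleteSpace E]

/-- Regularity for `∂₋u = L u + β` where `u = ∂₊a` is only known to be continuous. Multiplied by a
gauge `g` with `∂₋g = -g L`, the equation has the right side `g β`, so that `g u` is the Cauchy
transform of a function of class `C¹` up to a term that is smooth near the given point. -/
theorem contDiff_one_delPlus {a : ℂ → E} (ha : ContDiff ℝ 1 a) (ha' : ContDiff ℝ 1 (delMinus a))
    {L : ℂ → E →L[ℂ] E} (hL : ContDiff ℝ 1 L) {β : ℂ → E} (hβ : ContDiff ℝ 1 β)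
    (h : ∀ z, delPlus (delMinus a) z = L z (delPlus a z) + β z) : ContDiff ℝ 1 (delPlus a) := by
  rw [contDiff_iff_contDiffAt]
  intro z₀
  obtain ⟨g, χ, hg, hχ, hχc, hχ1, hu, hgL⟩ := exists_gauge hL z₀
  have hχ' : ContDiff ℝ 1 χ := hχ.of_le (by exact_mod_cast le_top)
  let φ : ℂ → E →L[ℂ] E := fun z => χ z • g z
  have hφ : ContDiff ℝ 1 φ := hχ'.smul hg
  have hφc : HasCompactSupport φ := hχc.smul_right
  have hdφ : ∀ w, delMinus φ w = delMinus χ w • g w - (χ w ^ 2) • (g w * L w) := fun w => by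
    have h1 := firstOrder_bilinear (c := 1 / 2) (d := I / 2)
      (ContinuousLinearMap.lsmul ℂ ℂ (E := E →L[ℂ] E)) (hχ'.differentiable one_ne_zero w)
      (hg.differentiable one_ne_zero w)
    simp only [ContinuousLinearMap.lsmul_apply] at h1
    refine h1.trans ?_
    rw [show firstOrder (1 / 2) (I / 2) g w = _ from hgL w]
    module
  let k : ℂ → E := fun w => delMinus χ w • g w (delPlus a w) +
    (χ w - χ w ^ 2) • g w (L w (delPlus a w))
  let m : ℂ → E := fun w => χ w • g w (β w)
  have hda : Continuous (delPlus a) := continuous_firstOrder ha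
  have hdχ : Continuous (delMinus χ) := continuous_firstOrder hχ'
  have hk : Continuous k := by
    have h1 := hg.continuous
    have h2 := hL.continuous
    have h3 := hχ'.continuous
    fun_prop
  have hkc : HasCompactSupport k := by
    refine HasCompactSupport.intro hχc.isCompact fun w hw => ?_
    have h1 : fderiv ℝ χ w = 0 := by_contra fun h => hw (support_fderiv_subset ℝ h)
    simp [k, firstOrder, h1, image_eq_zero_of_notMem_tsupport hw]
  have hm : ContDiff ℝ 1 m := by
    refine hχ'.smul ?_
    have := (((ContinuousLinearMap.apply ℂ E).flip).bilinearRestrictScalars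
        ℝ).isBoundedBilinearMap.contDiff.comp (hg.prodMk hβ)
    exact this
  have hmc : HasCompactSupport m := hχc.smul_right
  have hk0 : ∀ᶠ w in 𝓝 z₀, k w = 0 := by
    filter_upwards [hχ1, hχ1.eventually_nhds] with w hw hw'
    have h1 : fderiv ℝ χ w = 0 := by
      have : χ =ᶠ[𝓝 w] fun _ => 1 := hw'
      rw [this.fderiv_eq]; simp
    simp [k, firstOrder, h1, hw]
  have hrep : ∀ z, φ z (delPlus a z) = cauchyTransform k z + cauchyTransform m z := fun z => by
    rw [clm_delPlus_eq_cauchyTransform hφ hφc ha ha',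
      ← cauchyTransform_add hk hkc hm.continuous hmc]
    congr 1
    ext w
    rw [hdφ, h]
    simp only [φ, k, m, sub_apply, smul_apply,
      mul_apply_eq_comp, map_add]
    module
  have hsum : ContDiffAt ℝ 1 (fun z => cauchyTransform k z + cauchyTransform m z) z₀ :=
    ((contDiffAt_cauchyTransform hk hkc hk0).of_le (by exact_mod_cast le_top)).add
      (contDiff_cauchyTransform (n := 1) hm hmc).contDiffAt
  have hinv : ContDiffAt ℝ 1 (fun z => Ring.inverse (g z)) z₀ := by
    obtain ⟨x, hx⟩ := hu z₀
    have := contDiffAt_ringInverse (n := 1) ℝ x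
    rw [hx] at this
    exact this.comp z₀ hg.contDiffAt
  have hfin : ContDiffAt ℝ 1
      (fun z => Ring.inverse (g z) (cauchyTransform k z + cauchyTransform m z)) z₀ := by
    have := (((ContinuousLinearMap.apply ℂ E).flip).bilinearRestrictScalars
        ℝ).isBoundedBilinearMap.contDiff.contDiffAt.comp z₀ (hinv.prodMk hsum)
    exact this
  refine hfin.congr_of_eventuallyEq ?_
  filter_upwards [hχ1] with z hz
  rw [← hrep]
  simp only [φ, hz, one_smul]
  rw [← mul_apply_eq_comp, Ring.inverse_mul_cancel _ (hu z),
    one_apply_eq_self]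

end Regularity

section Regularity

variable {E F : Type*} [NormedAddCommGroup E] [NormedSpace ℂ E] [NormedAddCommGroup F]
  [NormedSpace ℂ F]

theorem contDiff_clm_comp {n : WithTop ℕ∞} (A : E →L[ℂ] F) {u : ℂ → E} (hu : ContDiff ℝ n u) :
    ContDiff ℝ n fun z => A (u z) :=
  (A.restrictScalars ℝ).contDiff.comp hu

theorem contDiffAt_clm_apply {n : WithTop ℕ∞} {L : ℂ → E →L[ℂ] F} {u : ℂ → E} {z : ℂ}
    (hL : ContDiffAt ℝ n L z) (hu : ContDiffAt ℝ n u z) :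
    ContDiffAt ℝ n (fun z => L z (u z)) z :=
  (((ContinuousLinearMap.apply ℂ F).flip).bilinearRestrictScalars
    ℝ).isBoundedBilinearMap.contDiff.contDiffAt.comp z (hL.prodMk hu)

theorem contDiff_clm_apply {n : WithTop ℕ∞} {L : ℂ → E →L[ℂ] F} {u : ℂ → E}
    (hL : ContDiff ℝ n L) (hu : ContDiff ℝ n u) : ContDiff ℝ n fun z => L z (u z) :=
  contDiff_iff_contDiffAt.2 fun _ => contDiffAt_clm_apply hL.contDiffAt hu.contDiffAt

theorem firstOrder_clm_apply {c d : ℂ} {L : ℂ → E →L[ℂ] F} {u : ℂ → E} {z : ℂ}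
    (hL : DifferentiableAt ℝ L z) (hu : DifferentiableAt ℝ u z) :
    firstOrder c d (fun z => L z (u z)) z =
      firstOrder c d L z (u z) + L z (firstOrder c d u z) :=
  firstOrder_bilinear (ContinuousLinearMap.apply ℂ F).flip hL hu

variable [CompleteSpace E]

/-- Solutions of class `C¹` of `∂₋u = L u + β` are as regular as the coefficients. -/
theorem contDiff_of_delMinus_eq (k : ℕ) : ∀ {u β : ℂ → E} {L : ℂ → E →L[ℂ] E},
    ContDiff ℝ 1 u → ContDiff ℝ (k + 1 : ℕ) L → ContDiff ℝ (k + 1 : ℕ) β →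
    (∀ z, delMinus u z = L z (u z) + β z) → ContDiff ℝ (k + 1 : ℕ) u := by
  induction k with
  | zero => intro u β L hu _ _ _; simpa using hu
  | succ k ih =>
    intro u β L hu hL hβ h
    have hle : ((k + 1 : ℕ) : WithTop ℕ∞) ≤ (k + 1 + 1 : ℕ) := by exact_mod_cast Nat.le_succ _
    have h1le : (1 : WithTop ℕ∞) ≤ (k + 1 : ℕ) := by exact_mod_cast Nat.le_add_left 1 k
    have hsucc : ((k + 1 : ℕ) : WithTop ℕ∞) + 1 ≤ (k + 1 + 1 : ℕ) := by exact_mod_cast le_rfl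
    have hL1 := hL.of_le hle
    have hβ1 := hβ.of_le hle
    have hu1 : ContDiff ℝ (k + 1 : ℕ) u := ih hu hL1 hβ1 h
    have hrhs : delMinus u = fun z => L z (u z) + β z := funext h
    have hm : ContDiff ℝ (k + 1 : ℕ) (delMinus u) := by
      rw [hrhs]
      exact (contDiff_clm_apply hL1 hu1).add hβ1
    let β' : ℂ → E := fun z => delPlus L z (u z) + delPlus β z
    have hβ' : ContDiff ℝ (k + 1 : ℕ) β' :=
      (contDiff_clm_apply (contDiff_firstOrder hL hsucc) hu1).add (contDiff_firstOrder hβ hsucc)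
    have hdiff := (hL1.of_le h1le).differentiable one_ne_zero
    have hdp : ∀ z, delPlus (delMinus u) z = L z (delPlus u z) + β' z := fun z => by
      rw [hrhs, delPlus, firstOrder_add
        ((contDiff_clm_apply (hL1.of_le h1le) hu).differentiable one_ne_zero z)
        ((hβ1.of_le h1le).differentiable one_ne_zero z),
        firstOrder_clm_apply (hdiff z) (hu.differentiable one_ne_zero z)]
      simp only [β']
      abel
    have hp1 : ContDiff ℝ 1 (delPlus u) :=
      contDiff_one_delPlus hu (hm.of_le h1le) (hL1.of_le h1le) (hβ'.of_le h1le) hdp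
    have hu2 : ContDiff ℝ 2 u := by
      have := contDiff_succ_of_firstOrder (n := 1) (hu.differentiable one_ne_zero)
        (by simpa using hp1) (by simpa using hm.of_le h1le)
      simpa [one_add_one_eq_two] using this
    have hp : ContDiff ℝ (k + 1 : ℕ) (delPlus u) := by
      refine ih hp1 hL1 hβ' fun z => ?_
      rw [delMinus, firstOrder_comm hu2.contDiffAt]
      exact hdp z
    exact contDiff_succ_of_firstOrder (hu.differentiable one_ne_zero) hp hm

/-- Higher regularity of `∂₊a` from an equation for `∂₊∂₋a`, without assuming that `∂₊a` is
differentiable. -/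
theorem contDiff_delPlus (k : ℕ) {a : ℂ → E} (ha : ContDiff ℝ 1 a)
    (ha' : ContDiff ℝ 1 (delMinus a)) {L : ℂ → E →L[ℂ] E} (hL : ContDiff ℝ (k + 1 : ℕ) L)
    {β : ℂ → E} (hβ : ContDiff ℝ (k + 1 : ℕ) β)
    (h : ∀ z, delPlus (delMinus a) z = L z (delPlus a z) + β z) :
    ContDiff ℝ (k + 1 : ℕ) (delPlus a) := by
  have h1le : (1 : WithTop ℕ∞) ≤ (k + 1 : ℕ) := by exact_mod_cast Nat.le_add_left 1 k
  have hp1 := contDiff_one_delPlus ha ha' (hL.of_le h1le) (hβ.of_le h1le) h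
  have ha2 : ContDiff ℝ 2 a := by
    have := contDiff_succ_of_firstOrder (n := 1) (ha.differentiable one_ne_zero)
      (by simpa using hp1) (by simpa using ha')
    simpa [one_add_one_eq_two] using this
  refine contDiff_of_delMinus_eq k hp1 hL hβ fun z => ?_
  rw [delMinus, firstOrder_comm ha2.contDiffAt]
  exact h z

theorem contDiff_infty_of_delMinus_eq {u : ℂ → E} {L : ℂ → E →L[ℂ] E} (hu : ContDiff ℝ 1 u)
    (hL : ContDiff ℝ ∞ L) (h : ∀ z, delMinus u z = L z (u z)) : ContDiff ℝ ∞ u := by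
  rw [contDiff_infty]
  intro k
  refine ContDiff.of_le (contDiff_of_delMinus_eq k hu (contDiff_infty.1 hL _)
    (β := fun _ => 0) contDiff_const fun z => by rw [h, add_zero]) ?_
  exact_mod_cast Nat.le_succ k

/-- Local structure of solutions of `∂₋A = L A` with smooth `L`: in the gauge `g`, the function
`g A` is holomorphic, so that `A` vanishes near `z₀` or is a power of `z - z₀` times a smooth
function that does not vanish at `z₀`. -/
theorem eventually_zero_or_eq_pow_smul {A : ℂ → E} (hA : ContDiff ℝ 1 A) {L : ℂ → E →L[ℂ] E}
    (hL : ContDiff ℝ ∞ L) (h : ∀ z, delMinus A z = L z (A z)) (z₀ : ℂ) :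
    (∀ᶠ z in 𝓝 z₀, A z = 0) ∨ ∃ (n : ℕ) (B : ℂ → E), ContDiffAt ℝ ∞ B z₀ ∧ B z₀ ≠ 0 ∧
      ∀ᶠ z in 𝓝 z₀, A z = (z - z₀) ^ n • B z := by
  obtain ⟨g, χ, hg, hχ, -, hχ1, hu, hgL⟩ := exists_gauge (hL.of_le (by exact_mod_cast le_top)) z₀
  have hgs : ContDiff ℝ ∞ g := by
    let T : ℂ → (E →L[ℂ] E) →L[ℂ] (E →L[ℂ] E) := fun z =>
      (ContinuousLinearMap.mul ℂ (E →L[ℂ] E)).flip ((-χ z) • L z)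
    have hT : ContDiff ℝ ∞ T := contDiff_clm_comp
      (F := (E →L[ℂ] E) →L[ℂ] (E →L[ℂ] E)) (ContinuousLinearMap.mul ℂ (E →L[ℂ] E)).flip
      (u := fun z => (-χ z) • L z) (hχ.neg.smul hL)
    refine contDiff_infty_of_delMinus_eq hg hT fun z => ?_
    rw [hgL]
    simp [T]
  let f : ℂ → E := fun z => g z (A z)
  have hf : ContDiff ℝ 1 f := contDiff_clm_apply hg hA
  have hf0 : ∀ᶠ z in 𝓝 z₀, DifferentiableAt ℂ f z := by
    filter_upwards [hχ1] with z hz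
    rw [differentiableAt_complex_iff_differentiableAt_real]
    refine ⟨hf.differentiable one_ne_zero z, ?_⟩
    have h1 : delMinus f z = 0 := by
      rw [delMinus, firstOrder_clm_apply (hg.differentiable one_ne_zero z)
        (hA.differentiable one_ne_zero z)]
      have e1 : firstOrder (1 / 2) (I / 2) g z = _ := hgL z
      have e2 : firstOrder (1 / 2) (I / 2) A z = _ := h z
      rw [e1, e2, hz]
      simp
    have h2 : fderiv ℝ f z I - I • fderiv ℝ f z 1 = (-2 * I) • delMinus f z := by
      simp only [firstOrder, smul_add, smul_smul]
      rw [show -2 * I * (I / 2) = 1 by linear_combination (-1) * I_sq]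
      module
    rw [h1, smul_zero] at h2
    exact sub_eq_zero.1 h2
  obtain ⟨s, hs, hsd⟩ := hf0.exists_mem
  have hfa : AnalyticAt ℂ f z₀ :=
    DifferentiableOn.analyticAt (fun z hz => (hsd z hz).differentiableWithinAt) hs
  have hcancel : ∀ z, Ring.inverse (g z) (f z) = A z := fun z => by
    simp only [f]
    rw [← mul_apply_eq_comp, Ring.inverse_mul_cancel _ (hu z), one_apply_eq_self]
  by_cases hz : ∀ᶠ z in 𝓝 z₀, f z = 0
  · left
    filter_upwards [hz] with z hz
    rw [← hcancel, hz, map_zero]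
  · right
    obtain ⟨n, b, hb, hb0, hfb⟩ := hfa.exists_eventuallyEq_pow_smul_nonzero_iff.2 hz
    refine ⟨n, fun z => Ring.inverse (g z) (b z), ?_, ?_, ?_⟩
    · have hinv : ContDiffAt ℝ ∞ (fun z => Ring.inverse (g z)) z₀ := by
        obtain ⟨x, hx⟩ := hu z₀
        have := contDiffAt_ringInverse (n := ∞) ℝ x
        rw [hx] at this
        exact this.comp z₀ hgs.contDiffAt
      exact contDiffAt_clm_apply hinv (hb.contDiffAt.restrict_scalars ℝ)
    · intro h0
      apply hb0
      have : g z₀ (Ring.inverse (g z₀) (b z₀)) = b z₀ := by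
        rw [← mul_apply_eq_comp, Ring.mul_inverse_cancel _ (hu z₀), one_apply_eq_self]
      rw [← this]
      exact (congrArg (g z₀) h0).trans (map_zero _)
    · filter_upwards [hfb] with z hz
      rw [← hcancel, hz, map_smul]

theorem eventually_zero_or_eventually_ne_zero {A : ℂ → E} (hA : ContDiff ℝ 1 A)
    {L : ℂ → E →L[ℂ] E} (hL : ContDiff ℝ ∞ L) (h : ∀ z, delMinus A z = L z (A z)) (z₀ : ℂ) :
    (∀ᶠ z in 𝓝 z₀, A z = 0) ∨ ∀ᶠ z in 𝓝[≠] z₀, A z ≠ 0 := by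
  refine (eventually_zero_or_eq_pow_smul hA hL h z₀).imp_right ?_
  rintro ⟨n, B, hB, hB0, hAB⟩
  have h1 : ∀ᶠ z in 𝓝 z₀, B z ≠ 0 := hB.continuousAt.eventually_ne hB0
  filter_upwards [nhdsWithin_le_nhds hAB, nhdsWithin_le_nhds h1, self_mem_nhdsWithin]
    with z h2 h3 h4
  rw [h2]
  exact smul_ne_zero (pow_ne_zero _ (sub_ne_zero.2 h4)) h3

/-- Unique continuation: a solution of `∂₋A = L A` vanishes identically or has isolated zeros. -/
theorem eq_zero_or_forall_eventually_ne_zero {A : ℂ → E} (hA : ContDiff ℝ 1 A)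
    {L : ℂ → E →L[ℂ] E} (hL : ContDiff ℝ ∞ L) (h : ∀ z, delMinus A z = L z (A z)) :
    (∀ z, A z = 0) ∨ ∀ z₀, ∀ᶠ z in 𝓝[≠] z₀, A z ≠ 0 := by
  let S : Set ℂ := {z₀ | ∀ᶠ z in 𝓝 z₀, A z = 0}
  have hopen : IsOpen S := isOpen_iff_eventually.2 fun z hz => hz.eventually_nhds
  have hclosed : IsClosed S := by
    rw [← isOpen_compl_iff, isOpen_iff_mem_nhds]
    intro z hz
    have h1 := (eventually_zero_or_eventually_ne_zero hA hL h z).resolve_left hz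
    have h2 : ∀ᶠ w in 𝓝 z, w ∉ S := by
      filter_upwards [eventually_nhdsWithin_iff.1 h1] with w hw hwS
      have hwS' : ∀ᶠ y in 𝓝 w, A y = 0 := hwS
      by_cases hwz : w = z
      · exact hz (hwz ▸ hwS)
      · exact hw hwz hwS'.self_of_nhds
    exact h2
  rcases isClopen_iff.1 ⟨hclosed, hopen⟩ with h0 | h0
  · right
    intro z₀
    refine (eventually_zero_or_eventually_ne_zero hA hL h z₀).resolve_left fun hz => ?_
    have : z₀ ∈ S := hz
    simp [h0] at this
  · left
    intro z
    have h1 : z ∈ S := by simp [h0]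
    have h2 : ∀ᶠ y in 𝓝 z, A y = 0 := h1
    exact h2.self_of_nhds

end Regularity

/-! ### Harmonic fields of idempotents -/

section Algebra

variable {R : Type*} [Ring R] {P a b D : R}

theorem idempotent_commute_mul (ha : a * P + P * a = a) (hb : b * P + P * b = b) :
    P * (a * b) = a * b * P := by
  linear_combination (norm := noncomm_ring) ha * b - a * hb

/-- The Euler–Lagrange equation in resolved form. Here `a`, `b`, `D` stand for `∂₊P`, `∂₋P`,
`∂₊∂₋P`. -/
theorem second_derivative_eq (hP : P * P = P)
    (hD : D * P + a * b + (b * a + P * D) = D) (hcomm : D * P = P * D) :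
    D = -((2 * P - 1) * (a * b + b * a)) := by
  linear_combination (norm := noncomm_ring)
    (2 * P - 1) * hD - 4 * hP * D - (2 * P - 1) * hcomm

theorem second_derivative_mul (hP : P * P = P) (ha : a * P + P * a = a) (hb : b * P + P * b = b)
    (hD : D * P + a * b + (b * a + P * D) = D) (hcomm : D * P = P * D) :
    D * P + a * b = a * P * b - b * (a * P) := by
  have h1 := idempotent_commute_mul ha hb
  have h2 := idempotent_commute_mul hb ha
  have h3 : D * P = -(a * b * P + b * a * P) := by
    rw [second_derivative_eq hP hD hcomm]
    linear_combination (norm := noncomm_ring)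
      -2 * h1 * P - 2 * h2 * P - 2 * a * b * hP - 2 * b * a * hP
  linear_combination (norm := noncomm_ring) h3 - a * hb

end Algebra

section BanachAlgebra

variable {𝒜 : Type*} [NormedRing 𝒜] [NormedAlgebra ℂ 𝒜] {c d : ℂ}

theorem firstOrder_mul {f g : ℂ → 𝒜} {z : ℂ} (hf : DifferentiableAt ℝ f z)
    (hg : DifferentiableAt ℝ g z) :
    firstOrder c d (fun w => f w * g w) z = firstOrder c d f z * g z + f z * firstOrder c d g z :=
  firstOrder_bilinear (ContinuousLinearMap.mul ℂ 𝒜) hf hg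

theorem firstOrder_const (x : 𝒜) (z : ℂ) : firstOrder c d (fun _ => x) z = 0 := by
  simp [firstOrder]

/-- `X` is a field of idempotents of class `C²` with `[∂₊∂₋X, X] = 0`. -/
structure IsHarmonicIdempotent (X : ℂ → 𝒜) : Prop where
  contDiff : ContDiff ℝ 2 X
  idem : ∀ z, X z * X z = X z
  euler_lagrange : ∀ z, delPlus (delMinus X) z * X z = X z * delPlus (delMinus X) z

theorem firstOrder_idem {X : ℂ → 𝒜} {z : ℂ} (hX : DifferentiableAt ℝ X z)
    (h : ∀ᶠ w in 𝓝 z, X w * X w = X w) :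
    firstOrder c d X z * X z + X z * firstOrder c d X z = firstOrder c d X z := by
  have h1 : (fun w => X w * X w) =ᶠ[𝓝 z] X := h
  rw [← firstOrder_mul hX hX, h1.firstOrder_eq]

namespace IsHarmonicIdempotent

variable {X : ℂ → 𝒜} (hX : IsHarmonicIdempotent X)
include hX

theorem contDiff_firstOrder : ContDiff ℝ 1 (firstOrder c d X) :=
  CPModel.contDiff_firstOrder hX.contDiff (by norm_num [one_add_one_eq_two])

theorem differentiable : Differentiable ℝ X := hX.contDiff.differentiable two_ne_zero

theorem firstOrder_split (z : ℂ) :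
    firstOrder c d X z * X z + X z * firstOrder c d X z = firstOrder c d X z :=
  firstOrder_idem (hX.differentiable z) (Filter.Eventually.of_forall hX.idem)

theorem second_split (z : ℂ) :
    delPlus (delMinus X) z * X z + delPlus X z * delMinus X z +
      (delMinus X z * delPlus X z + X z * delPlus (delMinus X) z) = delPlus (delMinus X) z := by
  have hb : Differentiable ℝ (delMinus X) := hX.contDiff_firstOrder.differentiable one_ne_zero
  have h1 : (fun w => delMinus X w * X w + X w * delMinus X w) = delMinus X :=
    funext fun w => hX.firstOrder_split w
  have h2 : delPlus (fun w => delMinus X w * X w + X w * delMinus X w) z =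
      delPlus (delMinus X) z := by rw [h1]
  rw [delPlus, firstOrder_add ((hb z).fun_mul (hX.differentiable z))
      ((hX.differentiable z).fun_mul (hb z)),
    firstOrder_mul (hb z) (hX.differentiable z), firstOrder_mul (hX.differentiable z) (hb z)] at h2
  refine Eq.trans ?_ h2
  simp only [delPlus]
  abel

theorem delMinus_delPlus (z : ℂ) : delMinus (delPlus X) z = delPlus (delMinus X) z :=
  firstOrder_comm hX.contDiff.contDiffAt

theorem delPlus_delMinus_eq (z : ℂ) : delPlus (delMinus X) z =
    -((2 * X z - 1) * (delPlus X z * delMinus X z + delMinus X z * delPlus X z)) :=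
  second_derivative_eq (hX.idem z) (hX.second_split z) (hX.euler_lagrange z)

/-- The equation `∂₋A = A b - b A` with `b = ∂₋X` for `A = ∂₊X X`. -/
theorem delMinus_delPlus_mul (z : ℂ) :
    delMinus (fun w => delPlus X w * X w) z =
      delPlus X z * X z * delMinus X z - delMinus X z * (delPlus X z * X z) := by
  have ha : Differentiable ℝ (delPlus X) := hX.contDiff_firstOrder.differentiable one_ne_zero
  rw [delMinus, firstOrder_mul (ha z) (hX.differentiable z)]
  have h : firstOrder (1 / 2) (I / 2) (delPlus X) z = _ := hX.delMinus_delPlus z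
  rw [h]
  exact second_derivative_mul (hX.idem z) (hX.firstOrder_split z) (hX.firstOrder_split z)
    (hX.second_split z) (hX.euler_lagrange z)

/-- Elliptic regularity. With `b = ∂₋X` as a coefficient, the derivative
`∂₊(∂₊∂₋X)` is affine in `∂₊∂₊X`, and the coefficients are as regular as `∂₊X` and `∂₋X`. The
equation gains regularity of `∂₊X` only; for Hermitian `X` the hypothesis on `∂₋X = (∂₊X)*`
holds. -/
theorem contDiff_infty [CompleteSpace 𝒜]
    (hstar : ∀ n : ℕ, ContDiff ℝ n (delPlus X) → ContDiff ℝ n (delMinus X)) :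
    ContDiff ℝ ∞ X := by
  have key : ∀ k : ℕ, ContDiff ℝ (k + 1 + 1 : ℕ) X := by
    intro k
    induction k with
    | zero => simpa [one_add_one_eq_two] using hX.contDiff
    | succ k ih =>
      have hsucc : ((k + 1 : ℕ) : WithTop ℕ∞) + 1 ≤ (k + 1 + 1 : ℕ) := by exact_mod_cast le_rfl
      have hX1 : ContDiff ℝ (k + 1 : ℕ) X := ih.of_le (by exact_mod_cast Nat.le_succ _)
      have ha : ContDiff ℝ (k + 1 : ℕ) (delPlus X) := CPModel.contDiff_firstOrder ih hsucc
      have hb : ContDiff ℝ (k + 1 : ℕ) (delMinus X) := CPModel.contDiff_firstOrder ih hsucc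
      have ha1 : ContDiff ℝ 1 (delPlus X) := hX.contDiff_firstOrder
      have hb1 : ContDiff ℝ 1 (delMinus X) := hX.contDiff_firstOrder
      have hDeq : delMinus (delPlus X) = fun z => -((2 * X z - 1) *
          (delPlus X z * delMinus X z + delMinus X z * delPlus X z)) :=
        funext fun z => (hX.delMinus_delPlus z).trans (hX.delPlus_delMinus_eq z)
      have hs : ContDiff ℝ (k + 1 : ℕ) fun z => 2 * X z - 1 :=
        (contDiff_const.mul hX1).sub contDiff_const
      have hq : ContDiff ℝ (k + 1 : ℕ) fun z =>
          delPlus X z * delMinus X z + delMinus X z * delPlus X z :=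
        (ha.mul hb).add (hb.mul ha)
      have hD : ContDiff ℝ (k + 1 : ℕ) (delMinus (delPlus X)) := by
        rw [hDeq]
        exact (hs.mul hq).neg
      have hD1 : ContDiff ℝ 1 (delMinus (delPlus X)) :=
        hD.of_le (by exact_mod_cast Nat.le_add_left 1 k)
      let lm := ContinuousLinearMap.mul ℂ 𝒜
      let L : ℂ → 𝒜 →L[ℂ] 𝒜 := fun z =>
        -(lm (2 * X z - 1) * (lm.flip (delMinus X z) + lm (delMinus X z)))
      have hL : ContDiff ℝ (k + 1 : ℕ) L :=
        ((contDiff_clm_comp lm hs).mul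
          ((contDiff_clm_comp lm.flip hb).add (contDiff_clm_comp lm hb))).neg
      let β : ℂ → 𝒜 := fun z =>
        -(2 * delPlus X z * (delPlus X z * delMinus X z + delMinus X z * delPlus X z)) -
        (2 * X z - 1) * (delPlus X z * delMinus (delPlus X) z +
          delMinus (delPlus X) z * delPlus X z)
      have hβ : ContDiff ℝ (k + 1 : ℕ) β :=
        ((contDiff_const.mul ha).mul hq).neg.sub (hs.mul ((ha.mul hD).add (hD.mul ha)))
      have heq : ∀ z, delPlus (delMinus (delPlus X)) z = L z (delPlus (delPlus X) z) + β z := by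
        intro z
        have da := ha1.differentiable one_ne_zero z
        have db := hb1.differentiable one_ne_zero z
        have dX := hX.differentiable z
        have e0 : (fun z => -((2 * X z - 1) *
            (delPlus X z * delMinus X z + delMinus X z * delPlus X z))) = fun z =>
            (1 - 2 * X z) * (delPlus X z * delMinus X z + delMinus X z * delPlus X z) := by
          ext w; noncomm_ring
        have e1 : firstOrder (1 / 2) (-(I / 2)) (fun z => 1 - 2 * X z) z = -(2 * delPlus X z) := by
          rw [firstOrder_sub (differentiableAt_const _) ((differentiableAt_const _).fun_mul dX),
            firstOrder_mul (differentiableAt_const _) dX, firstOrder_const, firstOrder_const,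
            zero_mul, zero_add, zero_sub]
        have e2 : firstOrder (1 / 2) (-(I / 2)) (delMinus X) z = delMinus (delPlus X) z :=
          (hX.delMinus_delPlus z).symm
        conv_lhs => rw [hDeq, e0]
        rw [delPlus, firstOrder_mul
          ((differentiableAt_const _).fun_sub ((differentiableAt_const _).fun_mul dX))
          ((da.fun_mul db).fun_add (db.fun_mul da)), e1,
          firstOrder_add (da.fun_mul db) (db.fun_mul da), firstOrder_mul da db,
          firstOrder_mul db da, e2]
        simp only [L, β, lm, neg_apply, mul_apply_eq_comp, add_apply,
          ContinuousLinearMap.flip_apply, ContinuousLinearMap.mul_apply']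
        noncomm_ring
      have hp : ContDiff ℝ (k + 1 : ℕ) (delPlus (delPlus X)) :=
        contDiff_delPlus k ha1 hD1 hL hβ heq
      have ha2 : ContDiff ℝ (k + 1 + 1 : ℕ) (delPlus X) :=
        contDiff_succ_of_firstOrder (ha1.differentiable one_ne_zero) hp hD
      exact contDiff_succ_of_firstOrder hX.differentiable ha2 (hstar _ ha2)
  rw [_root_.contDiff_infty]
  intro n
  exact (key n).of_le (by exact_mod_cast (Nat.le_succ n).trans (Nat.le_succ _))

end IsHarmonicIdempotent

end BanachAlgebra

/-! ### Matrix functions -/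

section Matrices

-- any submultiplicative norm would serve
attribute [local instance] Matrix.linftyOpNormedRing Matrix.linftyOpNormedAlgebra

/-- The uniformity of the operator norm on matrices. It agrees definitionally with the entrywise
uniformity, but instance search does not see this. -/
@[reducible] noncomputable def matUniformSpace (N : ℕ) : UniformSpace (Mat N) :=
  PseudoMetricSpace.toUniformSpace

/-- The topology of the operator norm on matrices. -/
@[reducible] noncomputable def matTopology (N : ℕ) : TopologicalSpace (Mat N) :=
  PseudoMetricSpace.toUniformSpace.toTopologicalSpace

attribute [local instance] matUniformSpace matTopology

variable {N : ℕ}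

theorem completeSpace_mat : CompleteSpace (Mat N) := FiniteDimensional.complete ℂ (Mat N)

attribute [local instance] completeSpace_mat

/-- The `(i, j)` entry of a matrix, as a continuous linear functional. -/
noncomputable def entryCLM (i j : Fin N) : Mat N →L[ℂ] ℂ :=
  LinearMap.toContinuousLinearMap (Matrix.entryLinearMap ℂ ℂ i j)

@[simp] theorem entryCLM_apply (i j : Fin N) (A : Mat N) : entryCLM i j A = A i j := rfl

/-- The trace of a matrix, as a continuous linear functional. -/
noncomputable def traceCLM : Mat N →L[ℂ] ℂ :=
  LinearMap.toContinuousLinearMap (Matrix.traceLinearMap (Fin N) ℂ ℂ)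

/-- The conjugate transpose, as a continuous real-linear map. -/
noncomputable def conjTransposeCLM : Mat N →L[ℝ] Mat N :=
  LinearMap.toContinuousLinearMap
    { toFun := fun A => Aᴴ
      map_add' := Matrix.conjTranspose_add
      map_smul' := fun r A => by
        ext i j
        simp }

@[simp] theorem conjTransposeCLM_apply (A : Mat N) : conjTransposeCLM A = Aᴴ := rfl

theorem contDiffAt_matrix {n : WithTop ℕ∞} {X : ℂ → Mat N} {z : ℂ} :
    ContDiffAt ℝ n X z ↔ ∀ i j, ContDiffAt ℝ n (fun w => X w i j) z := by
  constructor
  · intro h i j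
    exact ((entryCLM i j).restrictScalars ℝ).contDiff.contDiffAt.comp z h
  · intro h
    have h1 : X = fun w => ∑ i, ∑ j, X w i j • Matrix.single i j (1 : ℂ) := by
      ext w : 1
      conv_lhs => rw [Matrix.matrix_eq_sum_single (X w)]
      simp
    rw [h1]
    exact ContDiffAt.sum fun i _ => ContDiffAt.sum fun j _ => (h i j).smul contDiffAt_const

theorem contDiff_matrix {n : WithTop ℕ∞} {X : ℂ → Mat N} :
    ContDiff ℝ n X ↔ ∀ i j, ContDiff ℝ n fun w => X w i j := by
  simp only [contDiff_iff_contDiffAt, contDiffAt_matrix]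
  exact ⟨fun h i j z => h z i j, fun h z i j => h i j z⟩

theorem dPlus_eq_delPlus {X : ℂ → Mat N} {z : ℂ} (hX : DifferentiableAt ℝ X z) :
    dPlus X z = delPlus X z := by
  ext i j
  have h := firstOrder_clm_comp (c := 1 / 2) (d := -(I / 2)) (entryCLM i j) hX
  refine Eq.trans ?_ h
  simp only [dPlus, dPlusScalar, Matrix.of_apply, firstOrder, entryCLM_apply, smul_eq_mul]
  ring

theorem dMinus_eq_delMinus {X : ℂ → Mat N} {z : ℂ} (hX : DifferentiableAt ℝ X z) :
    dMinus X z = delMinus X z := by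
  ext i j
  have h := firstOrder_clm_comp (c := 1 / 2) (d := I / 2) (entryCLM i j) hX
  refine Eq.trans ?_ h
  simp only [dMinus, dMinusScalar, Matrix.of_apply, firstOrder, entryCLM_apply, smul_eq_mul]
  ring

theorem firstOrder_conjTranspose {c d : ℂ} {X : ℂ → Mat N} {z : ℂ}
    (hX : DifferentiableAt ℝ X z) :
    firstOrder c d (fun w => (X w)ᴴ) z = (firstOrder (star c) (star d) X z)ᴴ := by
  have h : HasFDerivAt (fun w => (X w)ᴴ) (conjTransposeCLM.comp (fderiv ℝ X z)) z :=
    conjTransposeCLM.hasFDerivAt.comp z hX.hasFDerivAt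
  simp only [firstOrder]
  rw [h.fderiv]
  simp [Matrix.conjTranspose_add, Matrix.conjTranspose_smul]

theorem delPlus_conjTranspose {X : ℂ → Mat N} {z : ℂ} (hX : DifferentiableAt ℝ X z) :
    delPlus (fun w => (X w)ᴴ) z = (delMinus X z)ᴴ := by
  rw [delPlus, firstOrder_conjTranspose hX]
  simp [delMinus, neg_div]

theorem delMinus_conjTranspose {X : ℂ → Mat N} {z : ℂ} (hX : DifferentiableAt ℝ X z) :
    delMinus (fun w => (X w)ᴴ) z = (delPlus X z)ᴴ := by
  rw [delMinus, firstOrder_conjTranspose hX]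
  simp [delPlus, neg_div]

namespace IsRankOneProjector

/-- A rank-one projector is an outer product, as its range has dimension `tr P = 1`. -/
theorem exists_eq_vecMulVec {P : Mat N} (hP : IsRankOneProjector P) :
    ∃ v w : Fin N → ℂ, P = Matrix.vecMulVec v w := by
  have hid : IsIdempotentElem (Matrix.toLin' P) := by
    rw [IsIdempotentElem, Module.End.mul_eq_comp, ← Matrix.toLin'_mul, hP.mul_self]
  have htr := (LinearMap.IsIdempotentElem.isProj_range _ hid).trace
  rw [Matrix.trace_toLin'_eq, hP.trace_eq_one] at htr
  have hfin : Module.finrank ℂ (LinearMap.range (Matrix.toLin' P)) = 1 := by exact_mod_cast htr.symm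
  obtain ⟨v, -, hv⟩ := finrank_eq_one_iff'.1 hfin
  choose w hw using fun j => hv ⟨Matrix.toLin' P (Pi.single j 1), LinearMap.mem_range_self _ _⟩
  refine ⟨v, w, ?_⟩
  ext i j
  have h1 := congrFun (congrArg Subtype.val (hw j)) i
  simp only [Submodule.coe_smul, Pi.smul_apply, smul_eq_mul, Matrix.toLin'_apply,
    Matrix.mulVec_single_one, Matrix.col_apply] at h1
  rw [Matrix.vecMulVec_apply, mul_comm, h1]

theorem mul_mul_eq {P : Mat N} (hP : IsRankOneProjector P) (M : Mat N) :
    P * M * P = (P * M * P).trace • P := by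
  obtain ⟨v, w, h⟩ := hP.exists_eq_vecMulVec
  have ht := hP.trace_eq_one
  have h1 : P * M * P = (w ⬝ᵥ (M *ᵥ v)) • P := by
    rw [h, Matrix.vecMulVec_mul, Matrix.vecMulVec_mul_vecMulVec, Matrix.dotProduct_mulVec,
      Matrix.vecMulVec_smul]
  rw [h1, Matrix.trace_smul, ht, smul_eq_mul, mul_one]

end IsRankOneProjector

/-! ### Harmonic rank-one projectors in the plane -/

theorem contDiff_conjTranspose {n : WithTop ℕ∞} {X : ℂ → Mat N} (hX : ContDiff ℝ n X) :
    ContDiff ℝ n fun z => (X z)ᴴ :=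
  conjTransposeCLM.contDiff.comp hX

theorem contDiffAt_conjTranspose {n : WithTop ℕ∞} {X : ℂ → Mat N} {z : ℂ}
    (hX : ContDiffAt ℝ n X z) : ContDiffAt ℝ n (fun z => (X z)ᴴ) z :=
  conjTransposeCLM.contDiff.contDiffAt.comp z hX

theorem contDiffAt_trace {n : WithTop ℕ∞} {X : ℂ → Mat N} {z : ℂ}
    (hX : ContDiffAt ℝ n X z) : ContDiffAt ℝ n (fun z => (X z).trace) z :=
  ((traceCLM (N := N)).restrictScalars ℝ).contDiff.contDiffAt.comp z hX

/-- `X` is a solution in the plane: a field of rank-one Hermitian projectors of class `C²` with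
`[∂₊∂₋X, X] = 0`. -/
structure IsHarmonicProjector (X : ℂ → Mat N) : Prop extends IsHarmonicIdempotent X where
  rankOne : ∀ z, IsRankOneProjector (X z)

/-- `∂₊X X`, a section of `Hom (im X, ker X)`. -/
noncomputable def secondForm (X : ℂ → Mat N) (z : ℂ) : Mat N := delPlus X z * X z

namespace IsHarmonicProjector

variable {X : ℂ → Mat N} (hX : IsHarmonicProjector X)
include hX

theorem hermitian (z : ℂ) : (X z)ᴴ = X z := (hX.rankOne z).hermitian

theorem conjTranspose_delPlus (z : ℂ) : (delPlus X z)ᴴ = delMinus X z := by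
  rw [← delMinus_conjTranspose (hX.differentiable z)]
  simp only [hX.hermitian]

theorem smooth : ContDiff ℝ ∞ X := by
  refine hX.toIsHarmonicIdempotent.contDiff_infty fun n hn => ?_
  have h : delMinus X = fun z => (delPlus X z)ᴴ := funext fun z => (hX.conjTranspose_delPlus z).symm
  rw [h]
  exact contDiff_conjTranspose hn

theorem contDiff_secondForm : ContDiff ℝ ∞ (secondForm X) :=
  (CPModel.contDiff_firstOrder hX.smooth (by simp)).mul hX.smooth

theorem conjTranspose_secondForm (z : ℂ) : (secondForm X z)ᴴ = X z * delMinus X z := by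
  rw [secondForm, Matrix.conjTranspose_mul, hX.hermitian, hX.conjTranspose_delPlus]

theorem raiseNum_eq (z : ℂ) : raiseNum X z = secondForm X z * (secondForm X z)ᴴ := by
  rw [hX.conjTranspose_secondForm, raiseNum, dPlus_eq_delPlus (hX.differentiable z),
    dMinus_eq_delMinus (hX.differentiable z), secondForm]
  linear_combination (norm := noncomm_ring) -delPlus X z * hX.idem z * delMinus X z

theorem trace_raiseNum_eq_zero_iff (z : ℂ) : (raiseNum X z).trace = 0 ↔ secondForm X z = 0 := by
  rw [hX.raiseNum_eq]
  open scoped ComplexOrder in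
  exact Matrix.trace_mul_conjTranspose_self_eq_zero_iff

theorem raiseNum_ne_zero_iff (z : ℂ) : raiseNum X z ≠ 0 ↔ secondForm X z ≠ 0 := by
  rw [not_iff_not]
  constructor
  · intro h
    rw [← hX.trace_raiseNum_eq_zero_iff, h, Matrix.trace_zero]
  · intro h
    rw [hX.raiseNum_eq, h, zero_mul]

theorem secondForm_mul (z : ℂ) : secondForm X z * X z = secondForm X z := by
  rw [secondForm, mul_assoc, hX.idem]

theorem mul_secondForm (z : ℂ) : X z * secondForm X z = 0 := by
  have h1 : delPlus X z * X z + X z * delPlus X z = delPlus X z := hX.firstOrder_split z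
  rw [secondForm]
  linear_combination (norm := noncomm_ring) h1 * X z - delPlus X z * hX.idem z

theorem mul_conjTranspose_secondForm (z : ℂ) : X z * (secondForm X z)ᴴ = (secondForm X z)ᴴ := by
  have := congrArg Matrix.conjTranspose (hX.secondForm_mul z)
  rwa [Matrix.conjTranspose_mul, hX.hermitian] at this

theorem conjTranspose_secondForm_mul (z : ℂ) : (secondForm X z)ᴴ * X z = 0 := by
  have := congrArg Matrix.conjTranspose (hX.mul_secondForm z)
  rwa [Matrix.conjTranspose_mul, hX.hermitian, Matrix.conjTranspose_zero] at this

/-- As `X` has rank one, `A* A` is a multiple of `X`, the factor being `tr (A A*)`. -/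
theorem conjTranspose_mul_secondForm (z : ℂ) :
    (secondForm X z)ᴴ * secondForm X z = (raiseNum X z).trace • X z := by
  have h1 : (secondForm X z)ᴴ * secondForm X z =
      X z * ((secondForm X z)ᴴ * secondForm X z) * X z := by
    rw [← mul_assoc, hX.mul_conjTranspose_secondForm, mul_assoc, hX.secondForm_mul]
  have h2 := (hX.rankOne z).mul_mul_eq ((secondForm X z)ᴴ * secondForm X z)
  rw [← h1] at h2
  rw [h2, Matrix.trace_mul_comm, hX.raiseNum_eq]

/-- The equation `∂₋A = [A, A*]` for `A = ∂₊X X`. -/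
theorem delMinus_secondForm (z : ℂ) : delMinus (secondForm X) z =
    secondForm X z * (secondForm X z)ᴴ - (secondForm X z)ᴴ * secondForm X z := by
  have h1 : delMinus (secondForm X) z = secondForm X z * delMinus X z -
      delMinus X z * secondForm X z := hX.delMinus_delPlus_mul z
  have h2 : delPlus X z * X z + X z * delPlus X z = delPlus X z := hX.firstOrder_split z
  have h3 : delMinus X z * X z + X z * delMinus X z = delMinus X z := hX.firstOrder_split z
  have h4 := idempotent_commute_mul h3 h2
  have h5 := hX.idem z
  rw [h1, hX.conjTranspose_secondForm, secondForm]
  linear_combination (norm := noncomm_ring) h4 * X z + delMinus X z * delPlus X z * h5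
    - delPlus X z * h5 * delMinus X z

theorem delMinus_secondForm_linear (z : ℂ) : delMinus (secondForm X) z =
    ((ContinuousLinearMap.mul ℂ (Mat N)).flip (delMinus X z) -
      ContinuousLinearMap.mul ℂ (Mat N) (delMinus X z)) (secondForm X z) :=
  hX.delMinus_delPlus_mul z

theorem contDiff_bracket : ContDiff ℝ ∞ fun z =>
    (ContinuousLinearMap.mul ℂ (Mat N)).flip (delMinus X z) -
      ContinuousLinearMap.mul ℂ (Mat N) (delMinus X z) :=
  have hb : ContDiff ℝ ∞ (delMinus X) := CPModel.contDiff_firstOrder hX.smooth (by simp)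
  (contDiff_clm_comp _ hb).sub (contDiff_clm_comp _ hb)

theorem secondForm_eq_zero_or : (∀ z, secondForm X z = 0) ∨
    ∀ z₀, ∀ᶠ z in 𝓝[≠] z₀, secondForm X z ≠ 0 :=
  eq_zero_or_forall_eventually_ne_zero (hX.contDiff_secondForm.of_le (by exact_mod_cast le_top))
    hX.contDiff_bracket hX.delMinus_secondForm_linear

/-- The normalized numerator extends smoothly across a zero of `A`: if `A = (z - z₀)ⁿ B`
with `B z₀ ≠ 0`, the factor `|z - z₀|²ⁿ` cancels. -/
theorem exists_local_extension {z₀ : ℂ} (h0 : ∀ᶠ z in 𝓝[≠] z₀, secondForm X z ≠ 0) :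
    ∃ y : ℂ → Mat N, ContDiffAt ℝ ∞ y z₀ ∧
      ∀ᶠ z in 𝓝 z₀, raiseNum X z ≠ 0 → (raiseNum X z).trace⁻¹ • raiseNum X z = y z := by
  have h1 := (eventually_zero_or_eq_pow_smul
    (hX.contDiff_secondForm.of_le (by exact_mod_cast le_top))
    hX.contDiff_bracket hX.delMinus_secondForm_linear z₀).resolve_left fun h => by
      obtain ⟨z, h2, h3⟩ := (h0.and (nhdsWithin_le_nhds h)).exists
      exact h2 h3
  obtain ⟨n, B, hB, hB0, hAB⟩ := h1
  have hBB : ContDiffAt ℝ ∞ (fun z => B z * (B z)ᴴ) z₀ := hB.mul (contDiffAt_conjTranspose hB)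
  have ht0 : (B z₀ * (B z₀)ᴴ).trace ≠ 0 := by
    open scoped ComplexOrder in
    rwa [Ne, Matrix.trace_mul_conjTranspose_self_eq_zero_iff]
  refine ⟨fun z => (B z * (B z)ᴴ).trace⁻¹ • (B z * (B z)ᴴ),
    ((contDiffAt_trace hBB).inv ht0).smul hBB, ?_⟩
  filter_upwards [hAB] with z hz hne
  have h2 : raiseNum X z = ((z - z₀) ^ n * star ((z - z₀) ^ n)) • (B z * (B z)ᴴ) := by
    rw [hX.raiseNum_eq, hz, Matrix.conjTranspose_smul, smul_mul_smul_comm]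
  have h3 : (z - z₀) ^ n * star ((z - z₀) ^ n) ≠ 0 := fun h => hne (by rw [h2, h, zero_smul])
  rw [h2, Matrix.trace_smul, smul_smul, smul_eq_mul, mul_inv, mul_assoc,
    mul_comm (Matrix.trace _)⁻¹, ← mul_assoc, inv_mul_cancel₀ h3, one_mul]

end IsHarmonicProjector

theorem isClosed_isRankOneProjector : IsClosed {A : Mat N | IsRankOneProjector A} := by
  have h : {A : Mat N | IsRankOneProjector A} =
      {A | A * A = A} ∩ ({A | conjTransposeCLM A = A} ∩ {A | traceCLM A = 1}) := by
    ext A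
    exact ⟨fun h => ⟨h.1, h.2, h.3⟩, fun h => ⟨h.1, h.2.1, h.2.2⟩⟩
  rw [h]
  exact (isClosed_eq (by fun_prop) continuous_id).inter
    ((isClosed_eq conjTransposeCLM.continuous continuous_id).inter
      (isClosed_eq traceCLM.continuous continuous_const))

namespace IsHarmonicProjector

variable {X : ℂ → Mat N} (hX : IsHarmonicProjector X)
include hX

theorem isRankOneProjector_quotient {z : ℂ} (h : raiseNum X z ≠ 0) :
    IsRankOneProjector ((raiseNum X z).trace⁻¹ • raiseNum X z) := by
  have ht : (raiseNum X z).trace ≠ 0 := by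
    rwa [Ne, hX.trace_raiseNum_eq_zero_iff, ← Ne, ← hX.raiseNum_ne_zero_iff]
  set t := (raiseNum X z).trace with ht_def
  have hF := hX.raiseNum_eq z
  have hsq : raiseNum X z * raiseNum X z = t • raiseNum X z := by
    have h1 := hX.conjTranspose_mul_secondForm z
    rw [← ht_def] at h1
    calc raiseNum X z * raiseNum X z
        = secondForm X z * ((secondForm X z)ᴴ * secondForm X z) * (secondForm X z)ᴴ := by
          rw [hF]; noncomm_ring
      _ = t • raiseNum X z := by
          rw [h1, mul_smul_comm, smul_mul_assoc, hX.secondForm_mul, ← hF]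
  have hherm : (raiseNum X z)ᴴ = raiseNum X z := by
    rw [hF, Matrix.conjTranspose_mul, Matrix.conjTranspose_conjTranspose]
  have htr : star t = t := by
    rw [ht_def, ← Matrix.trace_conjTranspose, hherm]
  refine ⟨?_, ?_, ?_⟩
  · rw [smul_mul_smul_comm, hsq, smul_smul]
    congr 1
    field_simp
  · rw [Matrix.conjTranspose_smul, hherm, star_inv₀, htr]
  · rw [Matrix.trace_smul, smul_eq_mul, ← ht_def, inv_mul_cancel₀ ht]

/-- The Euler–Lagrange equation for a smooth extension `Y` of the normalized numerator, where the
numerator does not vanish. It follows from `∂₋Y Y = -A*` and `∂₊A* = [A, A*]`. -/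
theorem euler_lagrange_quotient {Y : ℂ → Mat N} (hY : ContDiff ℝ 2 Y)
    (hYF : ∀ z, raiseNum X z ≠ 0 → Y z = (raiseNum X z).trace⁻¹ • raiseNum X z) {z : ℂ}
    (hz : raiseNum X z ≠ 0) :
    delPlus (delMinus Y) z * Y z = Y z * delPlus (delMinus Y) z := by
  let A := secondForm X
  have hA : ContDiff ℝ ∞ A := hX.contDiff_secondForm
  have hdA : Differentiable ℝ A := hA.differentiable (by simp)
  have hdY : Differentiable ℝ Y := hY.differentiable two_ne_zero
  have hev : ∀ᶠ w in 𝓝 z, raiseNum X w ≠ 0 := by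
    have h1 : ∀ᶠ w in 𝓝 z, A w ≠ 0 :=
      hA.continuous.continuousAt.eventually_ne ((hX.raiseNum_ne_zero_iff z).1 hz)
    filter_upwards [h1] with w hw
    exact (hX.raiseNum_ne_zero_iff w).2 hw
  -- pointwise relations on the open set where the numerator does not vanish
  have htne : ∀ w, raiseNum X w ≠ 0 → (raiseNum X w).trace ≠ 0 := by
    intro w hw
    rwa [Ne, hX.trace_raiseNum_eq_zero_iff, ← Ne, ← hX.raiseNum_ne_zero_iff]
  have hAA : ∀ w, raiseNum X w ≠ 0 → A w * (A w)ᴴ = (raiseNum X w).trace • Y w := by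
    intro w hw
    rw [hYF w hw, smul_smul, mul_inv_cancel₀ (htne w hw), one_smul, hX.raiseNum_eq]
  have hproj : ∀ w, raiseNum X w ≠ 0 → IsRankOneProjector (Y w) := by
    intro w hw
    rw [hYF w hw]
    exact hX.isRankOneProjector_quotient hw
  have hYA : ∀ w, raiseNum X w ≠ 0 → Y w * A w = A w := by
    intro w hw
    rw [hYF w hw, hX.raiseNum_eq, smul_mul_assoc, mul_assoc, hX.conjTranspose_mul_secondForm,
      mul_smul_comm, smul_smul, hX.secondForm_mul, ← hX.raiseNum_eq, inv_mul_cancel₀ (htne w hw),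
      one_smul]
  have hYX : ∀ w, raiseNum X w ≠ 0 → Y w * X w = 0 := by
    intro w hw
    rw [hYF w hw, hX.raiseNum_eq, smul_mul_assoc, mul_assoc, hX.conjTranspose_secondForm_mul,
      mul_zero, smul_zero]
  have hXY : ∀ w, raiseNum X w ≠ 0 → X w * Y w = 0 := by
    intro w hw
    rw [hYF w hw, hX.raiseNum_eq, mul_smul_comm, ← mul_assoc, hX.mul_secondForm,
      zero_mul, smul_zero]
  have hbY : ∀ w, raiseNum X w ≠ 0 → delMinus Y w * Y w = -(A w)ᴴ := by
    intro w hw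
    have hevw : ∀ᶠ v in 𝓝 w, raiseNum X v ≠ 0 := by
      have h1 : ∀ᶠ v in 𝓝 w, A v ≠ 0 :=
        hA.continuous.continuousAt.eventually_ne ((hX.raiseNum_ne_zero_iff w).1 hw)
      filter_upwards [h1] with v hv
      exact (hX.raiseNum_ne_zero_iff v).2 hv
    have h1 : (fun v => Y v * A v) =ᶠ[𝓝 w] A := by
      filter_upwards [hevw] with v hv
      exact hYA v hv
    have h2 : delMinus Y w * A w + Y w * delMinus A w = delMinus A w := by
      rw [delMinus, ← firstOrder_mul (hdY w) (hdA w)]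
      exact h1.firstOrder_eq
    have h3 : delMinus A w = A w * (A w)ᴴ - (A w)ᴴ * A w := hX.delMinus_secondForm w
    have h4 : (A w)ᴴ * A w = (raiseNum X w).trace • X w := hX.conjTranspose_mul_secondForm w
    have h5 : delMinus Y w * A w = -((A w)ᴴ * A w) := by
      rw [h3] at h2
      have h6 : Y w * (A w * (A w)ᴴ) = A w * (A w)ᴴ := by rw [← mul_assoc, hYA w hw]
      have h7 : Y w * ((A w)ᴴ * A w) = 0 := by rw [h4, mul_smul_comm, hYX w hw, smul_zero]
      linear_combination (norm := noncomm_ring) h2 - h6 + h7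
    have h6 : (raiseNum X w).trace • (delMinus Y w * Y w) =
        (raiseNum X w).trace • (-(A w)ᴴ) := by
      rw [← mul_smul_comm, ← hAA w hw, ← mul_assoc, h5, neg_mul, h4, smul_mul_assoc, smul_neg]
      congr 2
      exact hX.mul_conjTranspose_secondForm w
    exact smul_right_injective _ (htne w hw) h6
  -- derivative of `∂₋Y Y = -A*`
  have hb : Differentiable ℝ (delMinus Y) :=
    (CPModel.contDiff_firstOrder (m := 1) hY (by norm_num [one_add_one_eq_two])).differentiable
      one_ne_zero
  have hE : delPlus (delMinus Y) z * Y z + delMinus Y z * delPlus Y z =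
      -(A z * (A z)ᴴ - (A z)ᴴ * A z) := by
    have h1 : (fun w => delMinus Y w * Y w) =ᶠ[𝓝 z] fun w => (-1 : ℂ) • (A w)ᴴ := by
      filter_upwards [hev] with w hw
      rw [hbY w hw, neg_smul, one_smul]
    have h2 := h1.firstOrder_eq (c := 1 / 2) (d := -(I / 2))
    rw [firstOrder_mul (hb z) (hdY z)] at h2
    have hdAH : DifferentiableAt ℝ (fun w => (A w)ᴴ) z :=
      (contDiff_conjTranspose hA).differentiable (by simp) z
    have h3 := firstOrder_clm_comp (c := 1 / 2) (d := -(I / 2))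
      ((-1 : ℂ) • ContinuousLinearMap.id ℂ (Mat N)) hdAH
    simp only [smul_apply, ContinuousLinearMap.id_apply] at h3
    have h4 : delPlus (fun w => (A w)ᴴ) z = A z * (A z)ᴴ - (A z)ᴴ * A z := by
      rw [delPlus_conjTranspose (hdA z)]
      have : delMinus A z = A z * (A z)ᴴ - (A z)ᴴ * A z := hX.delMinus_secondForm z
      rw [this, Matrix.conjTranspose_sub, Matrix.conjTranspose_mul, Matrix.conjTranspose_mul,
        Matrix.conjTranspose_conjTranspose]
    refine h2.trans (h3.trans ?_)
    rw [neg_smul, one_smul]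
    exact congrArg Neg.neg h4
  have hYid : ∀ᶠ w in 𝓝 z, Y w * Y w = Y w := by
    filter_upwards [hev] with w hw
    exact (hproj w hw).mul_self
  have hc : Y z * (delMinus Y z * delPlus Y z) = delMinus Y z * delPlus Y z * Y z :=
    idempotent_commute_mul (firstOrder_idem (hdY z) hYid) (firstOrder_idem (hdY z) hYid)
  have hYY := (hproj z hz).mul_self
  have hEY : delPlus (delMinus Y) z * Y z = Y z * delPlus (delMinus Y) z * Y z := by
    have h1 : A z * (A z)ᴴ = (raiseNum X z).trace • Y z := hAA z hz
    have h2 : (A z)ᴴ * A z = (raiseNum X z).trace • X z := hX.conjTranspose_mul_secondForm z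
    rw [h1, h2] at hE
    have h3 : delPlus (delMinus Y) z * Y z = -(raiseNum X z).trace • Y z -
        delMinus Y z * delPlus Y z * Y z := by
      have h4 := congrArg (· * Y z) hE
      simp only [add_mul, mul_assoc, neg_mul, sub_mul, smul_mul_assoc, hYY, hXY z hz, smul_zero,
        sub_zero] at h4
      rw [eq_sub_iff_add_eq, mul_assoc, h4, neg_smul]
    rw [mul_assoc, h3, mul_sub, mul_smul_comm, hYY, ← mul_assoc, hc, mul_assoc _ (Y z), hYY]
  -- `hEY` says that `∂₊∂₋Y Y` is its own compression by `Y`; as `∂₊∂₋Y` is Hermitian, taking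
  -- adjoints turns it into `Y ∂₊∂₋Y`
  have hdM : delMinus (delPlus Y) z = delPlus (delMinus Y) z := firstOrder_comm hY.contDiffAt
  have hYherm : Y =ᶠ[𝓝 z] fun w => (Y w)ᴴ := by
    filter_upwards [hev] with w hw
    exact (hproj w hw).hermitian.symm
  have hEherm : (delPlus (delMinus Y) z)ᴴ = delPlus (delMinus Y) z := by
    rw [← delMinus_conjTranspose (hb z)]
    have h1 : (fun w => (delMinus Y w)ᴴ) =ᶠ[𝓝 z] delPlus Y := by
      filter_upwards [hYherm.eventually_nhds] with w hw
      rw [← delPlus_conjTranspose (hdY w)]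
      exact (Filter.EventuallyEq.firstOrder_eq hw).symm
    exact h1.firstOrder_eq.trans hdM
  have h1 := congrArg Matrix.conjTranspose hEY
  rw [Matrix.conjTranspose_mul, Matrix.conjTranspose_mul, Matrix.conjTranspose_mul, hEherm,
    (hproj z hz).hermitian] at h1
  exact hEY.trans ((mul_assoc _ _ _).trans h1.symm)

/-- The raising operator in the plane, away from the point at infinity: the normalized numerator
extends to a smooth solution with values in the rank-one projectors. -/
theorem exists_raise : (∀ z, raiseNum X z = 0) ∨ (Dense {z | raiseNum X z ≠ 0} ∧
    (∀ z, raiseNum X z ≠ 0 → (raiseNum X z).trace ≠ 0) ∧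
    ∃ Y : ℂ → Mat N, ContDiff ℝ ∞ Y ∧ IsHarmonicProjector Y ∧
      ∀ z, raiseNum X z ≠ 0 → Y z = (raiseNum X z).trace⁻¹ • raiseNum X z) := by
  refine hX.secondForm_eq_zero_or.imp (fun h z => ?_) fun h => ?_
  · rw [hX.raiseNum_eq, h, zero_mul]
  let D : Set ℂ := {z | raiseNum X z ≠ 0}
  have hD : Dense D := by
    intro z
    have h1 : ∀ᶠ w in 𝓝[≠] z, w ∈ D := by
      filter_upwards [h z] with w hw
      exact (hX.raiseNum_ne_zero_iff w).2 hw
    exact mem_closure_of_frequently_of_tendsto h1.frequently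
      (Filter.tendsto_id.mono_left nhdsWithin_le_nhds)
  have ht : ∀ z, raiseNum X z ≠ 0 → (raiseNum X z).trace ≠ 0 := by
    intro w hw
    rwa [Ne, hX.trace_raiseNum_eq_zero_iff, ← Ne, ← hX.raiseNum_ne_zero_iff]
  let f : ℂ → Mat N := fun z => (raiseNum X z).trace⁻¹ • raiseNum X z
  let Y : ℂ → Mat N := extendFrom D f
  have hloc : ∀ z₀, ∃ y : ℂ → Mat N, ContDiffAt ℝ ∞ y z₀ ∧ (∀ᶠ z in 𝓝 z₀, Y z = y z) ∧
      ∀ᶠ z in 𝓝 z₀, z ∈ D → f z = y z := by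
    intro z₀
    obtain ⟨y, hy, hfy⟩ := hX.exists_local_extension (h z₀)
    refine ⟨y, hy, ?_, hfy⟩
    have hy1 : ∀ᶠ z in 𝓝 z₀, ContinuousAt y z := by
      have := (hy.of_le (m := 1) (by exact_mod_cast le_top)).eventually (by simp)
      filter_upwards [this] with z hz
      exact hz.continuousAt
    filter_upwards [hy1, hfy.eventually_nhds] with z hz1 hz2
    refine extendFrom_eq (hD z) ?_
    refine (hz1.tendsto.mono_left nhdsWithin_le_nhds).congr' ?_
    filter_upwards [nhdsWithin_le_nhds hz2, self_mem_nhdsWithin] with w h1 h2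
    exact (h1 h2).symm
  have hYs : ContDiff ℝ ∞ Y := by
    rw [contDiff_iff_contDiffAt]
    intro z
    obtain ⟨y, hy, hYy, -⟩ := hloc z
    exact hy.congr_of_eventuallyEq hYy
  have hYf : ∀ z, raiseNum X z ≠ 0 → Y z = f z := by
    intro z hz
    obtain ⟨y, -, hYy, hfy⟩ := hloc z
    rw [hYy.self_of_nhds, hfy.self_of_nhds hz]
  have hY2 : ContDiff ℝ 2 Y := by exact_mod_cast contDiff_infty.1 hYs 2
  have hYproj : ∀ z, IsRankOneProjector (Y z) := by
    have h1 : IsClosed (Y ⁻¹' {A | IsRankOneProjector A}) :=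
      isClosed_isRankOneProjector.preimage hYs.continuous
    have h2 : D ⊆ Y ⁻¹' {A | IsRankOneProjector A} := fun z hz => by
      rw [Set.mem_preimage, hYf z hz]
      exact hX.isRankOneProjector_quotient hz
    intro z
    exact h1.closure_subset_iff.2 h2 (hD z)
  refine ⟨hD, ht, Y, hYs, ⟨⟨hY2, fun z => (hYproj z).mul_self, fun z => ?_⟩, hYproj⟩, hYf⟩
  have hEc : Continuous (delPlus (delMinus Y)) :=
    continuous_firstOrder (CPModel.contDiff_firstOrder hY2 (by norm_num [one_add_one_eq_two]))
  have := Continuous.ext_on hD (hEc.mul hYs.continuous) (hYs.continuous.mul hEc)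
    fun z hz => hX.euler_lagrange_quotient hY2 hYf hz
  exact congrFun this z

end IsHarmonicProjector

end Matrices

/-! ### Limits along the nonvanishing set -/

section Normalization

variable {N : ℕ}

theorem approach_coe_le (F : ℂ → Mat N) (z : ℂ) : approach F (z : OnePoint ℂ) ≤ 𝓝 z := by
  rw [approach, ← OnePoint.isOpenEmbedding_coe.isInducing.nhds_eq_comap]
  exact inf_le_left

theorem approach_infty_le (F : ℂ → Mat N) :
    approach F OnePoint.infty ≤ Filter.cocompact ℂ := by
  rw [approach, OnePoint.comap_coe_nhds_infty, Filter.coclosedCompact_eq_cocompact]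
  exact inf_le_left

theorem eventually_approach_ne_zero (F : ℂ → Mat N) (p : OnePoint ℂ) :
    ∀ᶠ z in approach F p, F z ≠ 0 :=
  Filter.mem_inf_of_right (Filter.mem_principal_self _)

theorem approach_neBot {F : ℂ → Mat N} (hF : Dense {z | F z ≠ 0}) (p : OnePoint ℂ) :
    (approach F p).NeBot := by
  have h : ∀ V : Set ℂ, IsOpen V → V.Nonempty → (V ∩ {z | F z ≠ 0}).Nonempty := fun V hV hne =>
    hF.inter_open_nonempty V hV hne
  refine Filter.inf_principal_neBot_iff.2 fun U hU => ?_
  induction p using OnePoint.rec with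
  | infty =>
    rw [OnePoint.comap_coe_nhds_infty, Filter.coclosedCompact_eq_cocompact,
      Filter.mem_cocompact] at hU
    obtain ⟨K, hK, hKU⟩ := hU
    exact (h Kᶜ hK.isClosed.isOpen_compl (Set.nonempty_compl.2 hK.ne_univ)).mono
      (Set.inter_subset_inter_left _ hKU)
  | coe z =>
    rw [← OnePoint.isOpenEmbedding_coe.isInducing.nhds_eq_comap] at hU
    obtain ⟨V, hVU, hV, hz⟩ := mem_nhds_iff.1 hU
    exact (h V hV ⟨z, hz⟩).mono (Set.inter_subset_inter_left _ hVU)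

theorem normalized_eq_of_tendsto {F : ℂ → Mat N} (hF : Dense {z | F z ≠ 0}) {p : OnePoint ℂ}
    {A : Mat N} (h : Filter.Tendsto (fun z => (F z).trace⁻¹ • F z) (approach F p) (𝓝 A)) :
    normalized F p = A := by
  have := approach_neBot hF p
  have h0 : ¬ ∀ z, F z = 0 := by
    obtain ⟨z, hz⟩ := hF.nonempty
    exact fun h => hz (h z)
  rw [normalized, if_neg h0]
  exact h.limUnder_eq

theorem normalized_eq_zero {F : ℂ → Mat N} (hF : ∀ z, F z = 0) (p : OnePoint ℂ) :
    normalized F p = 0 := by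
  rw [normalized, if_pos hF]

end Normalization

/-! ### Transposition -/

section Transpose

variable {N : ℕ}

theorem HasNormalization.transpose {F : ℂ → Mat N} (hF : HasNormalization F) :
    HasNormalization (fun z => (F z)ᵀ) ∧
      ∀ p, normalized (fun z => (F z)ᵀ) p = (normalized F p)ᵀ := by
  have hne : ∀ z, (F z)ᵀ ≠ 0 ↔ F z ≠ 0 := fun z => Matrix.transpose_eq_zero.not
  rcases hF with h | ⟨hd, ht, hl⟩
  · have h' : ∀ z, (F z)ᵀ = 0 := fun z => by rw [h, Matrix.transpose_zero]
    refine ⟨Or.inl h', fun p => ?_⟩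
    rw [normalized_eq_zero h', normalized_eq_zero h, Matrix.transpose_zero]
  · have hd' : Dense {z | (F z)ᵀ ≠ 0} := by simpa only [hne] using hd
    have happ : ∀ p, approach (fun z => (F z)ᵀ) p = approach F p := fun p => by
      simp only [approach, hne]
    have hlim : ∀ p A, Filter.Tendsto (fun z => (F z).trace⁻¹ • F z) (approach F p) (𝓝 A) →
        Filter.Tendsto (fun z => ((F z)ᵀ).trace⁻¹ • (F z)ᵀ) (approach (fun z => (F z)ᵀ) p)
          (𝓝 Aᵀ) := fun p A h => by
      rw [happ]
      simp only [Matrix.trace_transpose, ← Matrix.transpose_smul]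
      exact (continuous_id.matrix_transpose.tendsto A).comp h
    refine ⟨Or.inr ⟨hd', fun z hz => ?_, fun p => ?_⟩, fun p => ?_⟩
    · rw [Matrix.trace_transpose]
      exact ht z ((hne z).1 hz)
    · obtain ⟨A, hA⟩ := hl p
      exact ⟨_, hlim p A hA⟩
    · obtain ⟨A, hA⟩ := hl p
      rw [normalized_eq_of_tendsto hd hA, normalized_eq_of_tendsto hd' (hlim p A hA)]

theorem dPlus_transpose (X : ℂ → Mat N) : dPlus (fun z => (X z)ᵀ) = fun z => (dPlus X z)ᵀ := rfl

theorem dMinus_transpose (X : ℂ → Mat N) : dMinus (fun z => (X z)ᵀ) = fun z => (dMinus X z)ᵀ := rfl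

theorem raiseNum_transpose (X : ℂ → Mat N) :
    raiseNum (fun z => (X z)ᵀ) = fun z => (lowerNum X z)ᵀ := by
  ext z : 1
  rw [raiseNum, dPlus_transpose, dMinus_transpose, lowerNum, Matrix.transpose_mul,
    Matrix.transpose_mul, mul_assoc]

theorem IsRankOneProjector.transpose {A : Mat N} (hA : IsRankOneProjector A) :
    IsRankOneProjector Aᵀ := by
  refine ⟨?_, ?_, ?_⟩
  · rw [← Matrix.transpose_mul, hA.mul_self]
  · ext i j
    simpa using congrFun (congrFun hA.hermitian j) i
  · rw [Matrix.trace_transpose, hA.trace_eq_one]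

theorem IsCk.transpose {k : ℕ} {P : OnePoint ℂ → Mat N} (hP : IsCk k P) :
    IsCk k fun p => (P p)ᵀ :=
  ⟨fun i j => hP.1 j i, fun i j => hP.2 j i⟩

theorem IsSolution.transpose {P : OnePoint ℂ → Mat N} (hP : IsSolution P) :
    IsSolution fun p => (P p)ᵀ := by
  refine ⟨hP.isC2.transpose, fun z => ?_⟩
  have h := congrArg Matrix.transpose (hP.euler_lagrange z)
  rw [Matrix.transpose_sub, Matrix.transpose_mul, Matrix.transpose_mul, Matrix.transpose_zero,
    ← neg_sub, neg_eq_zero] at h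
  exact h

theorem lagrangian_transpose (P : OnePoint ℂ → Mat N) :
    lagrangian (fun p => (P p)ᵀ) = lagrangian P := by
  ext z
  have h : lagrangian (fun p => (P p)ᵀ) z =
      ((dPlus (planePart P) z)ᵀ * (dMinus (planePart P) z)ᵀ).trace := rfl
  rw [h, ← Matrix.transpose_mul, Matrix.trace_transpose, Matrix.trace_mul_comm, lagrangian]

/-- The lowering operator is the raising operator conjugated by transposition. -/
theorem lower_eq_transpose_raise {P : OnePoint ℂ → Mat N}
    (h : HasNormalization (raiseNum (planePart fun p => (P p)ᵀ))) :
    HasNormalization (lowerNum (planePart P)) ∧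
      lower P = fun p => (raise (fun q => (P q)ᵀ) p)ᵀ := by
  have h1 : raiseNum (planePart fun p => (P p)ᵀ) = fun z => (lowerNum (planePart P) z)ᵀ :=
    raiseNum_transpose (planePart P)
  have h2 := h.transpose
  simp only [h1, Matrix.transpose_transpose] at h2
  refine ⟨h2.1, funext fun p => ?_⟩
  rw [lower, raise, h1]
  exact h2.2 p

end Transpose

/-! ### Change of the holomorphic coordinate -/

section Inversion

variable {E : Type*} [NormedAddCommGroup E] [NormedSpace ℂ E]

theorem fderiv_comp_holomorphic {f : ℂ → E} {φ : ℂ → ℂ} {φ' w : ℂ} (hφ : HasDerivAt φ φ' w)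
    (hf : DifferentiableAt ℝ f (φ w)) (v : ℂ) :
    fderiv ℝ (fun u => f (φ u)) w v = fderiv ℝ f (φ w) (φ' * v) := by
  have h := hf.hasFDerivAt.comp w hφ.complexToReal_fderiv
  have h' : HasFDerivAt (fun u => f (φ u)) _ w := h
  rw [h'.fderiv]
  simp

theorem fderiv_mul_eq (f : ℂ → E) (z u : ℂ) :
    fderiv ℝ f z u = (u.re : ℂ) • fderiv ℝ f z 1 + (u.im : ℂ) • fderiv ℝ f z I := by
  conv_lhs => rw [show u = u.re • (1 : ℂ) + u.im • I by simp [Complex.re_add_im]]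
  rw [map_add, map_smul, map_smul, Complex.coe_smul, Complex.coe_smul]

theorem delPlus_comp_holomorphic {f : ℂ → E} {φ : ℂ → ℂ} {φ' w : ℂ} (hφ : HasDerivAt φ φ' w)
    (hf : DifferentiableAt ℝ f (φ w)) :
    delPlus (fun u => f (φ u)) w = φ' • delPlus f (φ w) := by
  simp only [firstOrder, fderiv_comp_holomorphic hφ hf]
  rw [fderiv_mul_eq f _ (φ' * 1), fderiv_mul_eq f _ (φ' * I)]
  have h := Complex.re_add_im φ'
  simp only [mul_one, Complex.mul_re, Complex.mul_im, Complex.I_re, Complex.I_im, mul_zero,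
    zero_sub, add_zero]
  conv_rhs => rw [← h]
  push_cast
  simp only [smul_add, smul_smul]
  match_scalars
  · ring
  · linear_combination ((φ'.im : ℂ) / 2) * I_sq

theorem delMinus_comp_holomorphic {f : ℂ → E} {φ : ℂ → ℂ} {φ' w : ℂ} (hφ : HasDerivAt φ φ' w)
    (hf : DifferentiableAt ℝ f (φ w)) :
    delMinus (fun u => f (φ u)) w = star φ' • delMinus f (φ w) := by
  simp only [firstOrder, fderiv_comp_holomorphic hφ hf]
  rw [fderiv_mul_eq f _ (φ' * 1), fderiv_mul_eq f _ (φ' * I)]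
  have h : star φ' = φ'.re - φ'.im * I := by
    apply Complex.ext <;> simp
  simp only [mul_one, Complex.mul_re, Complex.mul_im, Complex.I_re, Complex.I_im, mul_zero,
    zero_sub, add_zero]
  rw [h]
  push_cast
  simp only [smul_add, smul_smul]
  match_scalars
  · ring
  · linear_combination ((φ'.im : ℂ) / 2) * I_sq

theorem delPlus_star_holomorphic {φ : ℂ → ℂ} {φ' w : ℂ} (hφ : HasDerivAt φ φ' w) :
    delPlus (fun u => star (φ u)) w = 0 := by
  have h1 : HasFDerivAt (fun u : ℂ => star u) (conjCLE : ℂ →L[ℝ] ℂ) (φ w) :=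
    conjCLE.hasFDerivAt
  rw [delPlus_comp_holomorphic (f := fun u => star u) hφ h1.differentiableAt]
  simp only [firstOrder]
  rw [h1.fderiv]
  simp
  right
  linear_combination (1 / 2) * I_sq

end Inversion

/-! ### The extended plane -/

section Sphere

attribute [local instance] Matrix.linftyOpNormedRing Matrix.linftyOpNormedAlgebra
attribute [local instance] matUniformSpace matTopology
attribute [local instance] completeSpace_mat
variable {N : ℕ}

theorem inversion_of_ne_zero (P : OnePoint ℂ → Mat N) {w : ℂ} (hw : w ≠ 0) :
    inversion P w = planePart P w⁻¹ := by
  rw [inversion, invChart, if_neg hw, planePart]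

theorem inversion_zero (P : OnePoint ℂ → Mat N) : inversion P 0 = P OnePoint.infty := by
  rw [inversion, invChart, if_pos rfl]

theorem inversion_inv (P : OnePoint ℂ → Mat N) {z : ℂ} (hz : z ≠ 0) :
    inversion P z⁻¹ = planePart P z := by
  rw [inversion_of_ne_zero P (inv_ne_zero hz), inv_inv]

theorem isCk_iff {k : ℕ} {P : OnePoint ℂ → Mat N} :
    IsCk k P ↔ ContDiff ℝ k (planePart P) ∧ ContDiff ℝ k (inversion P) := by
  rw [IsCk, contDiff_matrix, contDiff_matrix]

section InvChart

variable {X Y : ℂ → Mat N}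

/-- The transformation of `∂₊` and `∂₋` under `w = 1/ξ`. -/
theorem firstOrder_inversion (hX : Differentiable ℝ X) (hXY : ∀ w, w ≠ 0 → Y w = X w⁻¹) {w : ℂ}
    (hw : w ≠ 0) : delPlus Y w = (-(w ^ 2)⁻¹) • delPlus X w⁻¹ ∧
      delMinus Y w = star (-(w ^ 2)⁻¹) • delMinus X w⁻¹ := by
  have hev : Y =ᶠ[𝓝 w] fun u => X u⁻¹ := by
    filter_upwards [isOpen_ne.mem_nhds hw] with u hu
    exact hXY u hu
  have hinv := hasDerivAt_inv hw
  rw [delPlus, delMinus, hev.firstOrder_eq, hev.firstOrder_eq]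
  exact ⟨delPlus_comp_holomorphic (φ := fun u => u⁻¹) hinv (hX _),
    delMinus_comp_holomorphic (φ := fun u => u⁻¹) hinv (hX _)⟩

theorem raiseNum_inversion (hX : Differentiable ℝ X) (hY : Differentiable ℝ Y)
    (hXY : ∀ w, w ≠ 0 → Y w = X w⁻¹) {w : ℂ} (hw : w ≠ 0) :
    ∃ c : ℂ, c ≠ 0 ∧ raiseNum Y w = c • raiseNum X w⁻¹ := by
  obtain ⟨h1, h2⟩ := firstOrder_inversion hX hXY hw
  have h0 : -(w ^ 2)⁻¹ ≠ 0 := neg_ne_zero.2 (inv_ne_zero (pow_ne_zero _ hw))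
  refine ⟨-(w ^ 2)⁻¹ * star (-(w ^ 2)⁻¹), mul_ne_zero h0 (star_ne_zero.2 h0), ?_⟩
  rw [raiseNum, raiseNum, dPlus_eq_delPlus (hX _), dMinus_eq_delMinus (hX _),
    dPlus_eq_delPlus (hY _), dMinus_eq_delMinus (hY _), h1, h2, hXY w hw, smul_mul_assoc,
    smul_mul_smul_comm]

/-- Conformal invariance of the Euler–Lagrange equation under `w = 1/ξ`. -/
theorem IsHarmonicProjector.of_inversion (hX : IsHarmonicProjector X) (hY : ContDiff ℝ 2 Y)
    (hYP : ∀ w, IsRankOneProjector (Y w)) (hXY : ∀ w, w ≠ 0 → Y w = X w⁻¹) :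
    IsHarmonicProjector Y := by
  refine ⟨⟨hY, fun w => (hYP w).mul_self, fun w => ?_⟩, hYP⟩
  have hEc : Continuous (delPlus (delMinus Y)) :=
    continuous_firstOrder (contDiff_firstOrder hY (by norm_num [one_add_one_eq_two]))
  -- the identity holds where `w ≠ 0` by the chain rule, and at `0` by continuity
  have hdense : Dense ({0}ᶜ : Set ℂ) := dense_compl_singleton 0
  refine congrFun (Continuous.ext_on hdense (hEc.mul hY.continuous) (hY.continuous.mul hEc)
    fun w hw => ?_) w
  have hw : w ≠ 0 := hw
  have hb : Differentiable ℝ (delMinus X) := hX.contDiff_firstOrder.differentiable one_ne_zero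
  have hev : delMinus Y =ᶠ[𝓝 w] fun u => star (-(u ^ 2)⁻¹) • delMinus X u⁻¹ := by
    filter_upwards [isOpen_ne.mem_nhds hw] with u hu
    exact (firstOrder_inversion hX.differentiable hXY hu).2
  have hψ : HasDerivAt (fun u : ℂ => -(u ^ 2)⁻¹) (-(-(2 * w) / (w ^ 2) ^ 2)) w := by
    have := ((hasDerivAt_pow 2 w).fun_inv (pow_ne_zero 2 hw)).neg
    simpa using! this
  have hinv := hasDerivAt_inv hw
  have hdψ : DifferentiableAt ℝ (fun u : ℂ => star (-(u ^ 2)⁻¹)) w :=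
    conjCLE.differentiableAt.comp w (hψ.differentiableAt.restrictScalars ℝ)
  have hdb : DifferentiableAt ℝ (fun u => delMinus X u⁻¹) w :=
    (hb _).comp w (hinv.differentiableAt.restrictScalars ℝ)
  have hE : delPlus (delMinus Y) w =
      (star (-(w ^ 2)⁻¹) * -(w ^ 2)⁻¹) • delPlus (delMinus X) w⁻¹ := by
    rw [delPlus, hev.firstOrder_eq]
    have h1 := firstOrder_bilinear (c := 1 / 2) (d := -(I / 2))
      (ContinuousLinearMap.lsmul ℂ ℂ (E := Mat N)) hdψ hdb
    have h2 : firstOrder (1 / 2) (-(I / 2)) (fun u : ℂ => star (-(u ^ 2)⁻¹)) w = 0 :=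
      delPlus_star_holomorphic hψ
    have h3 : firstOrder (1 / 2) (-(I / 2)) (fun u => delMinus X u⁻¹) w = _ :=
      delPlus_comp_holomorphic (φ := fun u => u⁻¹) hinv (hb _)
    simp only [ContinuousLinearMap.lsmul_apply] at h1
    rw [h1, h2, h3, zero_smul, zero_add, smul_smul]
  change delPlus (delMinus Y) w * Y w = Y w * delPlus (delMinus Y) w
  rw [hE, hXY w hw, smul_mul_assoc, mul_smul_comm, hX.euler_lagrange]

end InvChart

theorem IsSolution.isHarmonicProjector {P : OnePoint ℂ → Mat N} (hP : IsSolution P)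
    (hproj : ∀ p, IsRankOneProjector (P p)) :
    IsHarmonicProjector (planePart P) ∧ IsHarmonicProjector (inversion P) := by
  obtain ⟨h1, h2⟩ := isCk_iff.1 hP.isC2
  have hX : ContDiff ℝ 2 (planePart P) := by exact_mod_cast h1
  have hY : ContDiff ℝ 2 (inversion P) := by exact_mod_cast h2
  have hd : dMinus (planePart P) = delMinus (planePart P) :=
    funext fun z => dMinus_eq_delMinus (hX.differentiable two_ne_zero z)
  have hb : Differentiable ℝ (delMinus (planePart P)) :=
    (contDiff_firstOrder (m := 1) hX (by norm_num [one_add_one_eq_two])).differentiable one_ne_zero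
  have hharm : IsHarmonicProjector (planePart P) := by
    refine ⟨⟨hX, fun z => (hproj z).mul_self, fun z => ?_⟩, fun z => hproj z⟩
    have := hP.euler_lagrange z
    rw [hd, dPlus_eq_delPlus (hb z)] at this
    exact sub_eq_zero.1 this
  exact ⟨hharm, hharm.of_inversion hY (fun w => hproj _) fun w hw => inversion_of_ne_zero P hw⟩

theorem IsHarmonicProjector.isSolution {Q : OnePoint ℂ → Mat N}
    (hX : IsHarmonicProjector (planePart Q)) (hY : ContDiff ℝ 2 (inversion Q)) :
    IsSolution Q := by
  refine ⟨isCk_iff.2 ⟨by exact_mod_cast hX.contDiff, by exact_mod_cast hY⟩, fun z => ?_⟩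
  have hd : dMinus (planePart Q) = delMinus (planePart Q) :=
    funext fun z => dMinus_eq_delMinus (hX.differentiable z)
  have hb : Differentiable ℝ (delMinus (planePart Q)) :=
    hX.contDiff_firstOrder.differentiable one_ne_zero
  rw [hd, dPlus_eq_delPlus (hb z), sub_eq_zero]
  exact hX.euler_lagrange z

/-- A function of class `C¹` on the extended plane has finite action: its Lagrangian density
decays like `|ξ|⁻⁴`. -/
theorem hasFiniteAction_of_contDiff {Q : OnePoint ℂ → Mat N} (hX : ContDiff ℝ 1 (planePart Q))
    (hY : ContDiff ℝ 1 (inversion Q)) : HasFiniteAction Q := by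
  have hdens : ∀ {Z : ℂ → Mat N}, ContDiff ℝ 1 Z →
      Continuous fun z => (delPlus Z z * delMinus Z z).trace := fun hZ =>
    traceCLM.continuous.comp ((continuous_firstOrder hZ).mul (continuous_firstOrder hZ))
  have hlag : ∀ z, lagrangian Q z =
      (delPlus (planePart Q) z * delMinus (planePart Q) z).trace := fun z => by
    rw [lagrangian, dPlus_eq_delPlus (hX.differentiable one_ne_zero z),
      dMinus_eq_delMinus (hX.differentiable one_ne_zero z)]
  obtain ⟨C₁, hC₁⟩ := (isCompact_closedBall (0 : ℂ) 1).exists_bound_of_continuousOn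
    (hdens hX).continuousOn
  obtain ⟨C₂, hC₂⟩ := (isCompact_closedBall (0 : ℂ) 1).exists_bound_of_continuousOn
    (hdens hY).continuousOn
  have hC₁0 : 0 ≤ C₁ := (norm_nonneg _).trans (hC₁ 0 (by simp))
  have hC₂0 : 0 ≤ C₂ := (norm_nonneg _).trans (hC₂ 0 (by simp))
  have hint : Integrable fun z : ℂ => 16 * (C₁ + C₂) * (1 + ‖z‖) ^ (-4 : ℝ) :=
    (integrable_one_add_norm (by rw [Complex.finrank_real_complex]; norm_num)).const_mul _
  have hcont : Continuous (lagrangian Q) := by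
    rw [funext hlag]
    exact hdens hX
  refine hint.mono' hcont.aestronglyMeasurable (Filter.Eventually.of_forall fun z => ?_)
  have hpow : (1 + ‖z‖) ^ (-4 : ℝ) = ((1 + ‖z‖) ^ 4)⁻¹ := by
    rw [Real.rpow_neg (by positivity)]
    norm_cast
  rw [hpow, ← div_eq_mul_inv, le_div_iff₀ (by positivity), hlag]
  rcases le_total ‖z‖ 1 with hz | hz
  · have h1 := hC₁ z (by simpa using hz)
    have h2 : (1 + ‖z‖) ^ 4 ≤ 16 := by
      calc (1 + ‖z‖) ^ 4 ≤ (1 + 1) ^ 4 := by gcongr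
        _ = 16 := by norm_num
    calc _ ≤ C₁ * 16 := mul_le_mul h1 h2 (by positivity) hC₁0
      _ ≤ _ := by linarith
  · have hz0 : z ≠ 0 := fun h => by rw [h, norm_zero] at hz; linarith
    have hzi : z⁻¹ ∈ Metric.closedBall (0 : ℂ) 1 := by
      simpa using inv_le_one_of_one_le₀ hz
    have h1 := hC₂ z⁻¹ hzi
    obtain ⟨e1, e2⟩ := firstOrder_inversion (hY.differentiable one_ne_zero)
      (fun w hw => (inversion_inv Q hw).symm) hz0
    have h3 : ‖-(z ^ 2)⁻¹‖ = (‖z‖ ^ 2)⁻¹ := by rw [norm_neg, norm_inv, norm_pow]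
    rw [e1, e2, smul_mul_smul_comm, Matrix.trace_smul, norm_smul, norm_mul, norm_star, h3]
    have h4 : (1 + ‖z‖) ^ 4 ≤ 16 * ‖z‖ ^ 4 := by
      calc (1 + ‖z‖) ^ 4 ≤ (‖z‖ + ‖z‖) ^ 4 := by gcongr
        _ = 16 * ‖z‖ ^ 4 := by ring
    have hzp : 0 < ‖z‖ := by linarith
    calc _ ≤ (‖z‖ ^ 2)⁻¹ * (‖z‖ ^ 2)⁻¹ * C₂ * (16 * ‖z‖ ^ 4) := by gcongr
      _ = 16 * C₂ := by field_simp
      _ ≤ _ := by linarith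

/-- The normalization exists, and `raise P` is zero or a smooth solution with values in the
rank-one projectors. Near `∞` the planar result applies to `inversion P`, whose numerator is a
nonvanishing scalar multiple of that of `P`; the scalar cancels in the normalization. -/
theorem exists_smooth_normalization {P : OnePoint ℂ → Mat N} (hP : IsSolution P)
    (hproj : ∀ p, IsRankOneProjector (P p)) :
    HasNormalization (raiseNum (planePart P)) ∧ ((∀ p, raise P p = 0) ∨
      (∀ p, IsRankOneProjector (raise P p)) ∧ IsHarmonicProjector (planePart (raise P)) ∧
        ContDiff ℝ ∞ (planePart (raise P)) ∧ ContDiff ℝ ∞ (inversion (raise P))) := by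
  obtain ⟨hX, hY⟩ := hP.isHarmonicProjector hproj
  set F := raiseNum (planePart P) with hF
  rcases hX.exists_raise with h | ⟨hd, ht, U, hUs, hU, hUF⟩
  · exact ⟨Or.inl h, Or.inl fun p => normalized_eq_zero h p⟩
  have hFF : ∀ w, w ≠ 0 → ∃ c : ℂ, c ≠ 0 ∧ raiseNum (inversion P) w = c • F w⁻¹ := fun w hw =>
    raiseNum_inversion hX.differentiable hY.differentiable
      (fun w hw => inversion_of_ne_zero P hw) hw
  obtain ⟨-, -, V, hVs, hV, hVF⟩ := hY.exists_raise.resolve_left fun h => by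
    obtain ⟨z, hz, hz0⟩ := hd.inter_open_nonempty {0}ᶜ isOpen_compl_singleton ⟨1, by simp⟩
    have hz : z ≠ 0 := hz
    obtain ⟨c, hc, hcF⟩ := hFF z⁻¹ (inv_ne_zero hz)
    rw [h, inv_inv] at hcF
    exact hz0 ((smul_eq_zero.1 hcF.symm).resolve_left hc)
  have hquot : ∀ z, z ≠ 0 → F z ≠ 0 → (F z).trace⁻¹ • F z = V z⁻¹ := by
    intro z hz hFz
    obtain ⟨c, hc, hcF⟩ := hFF z⁻¹ (inv_ne_zero hz)
    rw [inv_inv] at hcF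
    rw [hVF _ (by rw [hcF]; exact smul_ne_zero hc hFz), hcF, Matrix.trace_smul, smul_smul,
      smul_eq_mul, mul_inv, mul_comm c⁻¹, mul_assoc, inv_mul_cancel₀ hc, mul_one]
  have hlim : ∀ z : ℂ, Filter.Tendsto (fun z => (F z).trace⁻¹ • F z)
      (approach F (z : OnePoint ℂ)) (𝓝 (U z)) := by
    intro z
    refine ((hUs.continuous.tendsto z).mono_left (approach_coe_le F z)).congr' ?_
    filter_upwards [eventually_approach_ne_zero F z] with w hw
    exact hUF w hw
  have hlim' : Filter.Tendsto (fun z => (F z).trace⁻¹ • F z)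
      (approach F OnePoint.infty) (𝓝 (V 0)) := by
    have h1 : Filter.Tendsto (fun z : ℂ => z⁻¹) (approach F OnePoint.infty) (𝓝 0) := by
      have := Filter.tendsto_inv₀_cobounded (α := ℂ)
      rw [Metric.cobounded_eq_cocompact] at this
      exact this.mono_left (approach_infty_le F)
    refine ((hVs.continuous.tendsto 0).comp h1).congr' ?_
    have h2 : ∀ᶠ z in approach F OnePoint.infty, z ≠ 0 :=
      approach_infty_le F (isCompact_singleton (x := (0 : ℂ))).compl_mem_cocompact
    filter_upwards [eventually_approach_ne_zero F _, h2] with w hw hw0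
    exact (hquot w hw0 hw).symm
  have hcoe : ∀ z : ℂ, raise P z = U z := fun z => normalized_eq_of_tendsto hd (hlim z)
  have hinf : raise P OnePoint.infty = V 0 := normalized_eq_of_tendsto hd hlim'
  have hplane : planePart (raise P) = U := funext hcoe
  have hinversion : inversion (raise P) = V := by
    ext w : 1
    by_cases hw : w = 0
    · rw [hw, inversion_zero, hinf]
    · rw [inversion_of_ne_zero _ hw, hplane]
      -- `U (1/w) = V w` by density, as `F` may vanish at `1/w`
      have : (𝓝[{z | F z ≠ 0}] w⁻¹).NeBot := mem_closure_iff_nhdsWithin_neBot.1 (hd _)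
      refine tendsto_nhds_unique (f := U) (l := 𝓝[{z | F z ≠ 0}] w⁻¹)
        ((hUs.continuous.tendsto _).mono_left nhdsWithin_le_nhds) ?_
      have h1 : Filter.Tendsto (fun z : ℂ => V z⁻¹) (𝓝 w⁻¹) (𝓝 (V w)) := by
        have h2 := (continuousAt_inv₀ (inv_ne_zero hw)).tendsto
        rw [inv_inv] at h2
        exact (hVs.continuous.tendsto w).comp h2
      refine (h1.mono_left nhdsWithin_le_nhds).congr' ?_
      filter_upwards [self_mem_nhdsWithin,
        nhdsWithin_le_nhds (isOpen_ne.mem_nhds (inv_ne_zero hw))] with z hz hz0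
      rw [hUF z hz, hquot z hz0 hz]
  refine ⟨Or.inr ⟨hd, ht, fun p => ?_⟩, Or.inr ⟨fun p => ?_, ?_, ?_, ?_⟩⟩
  · induction p using OnePoint.rec with
    | infty => exact ⟨_, hlim'⟩
    | coe z => exact ⟨_, hlim z⟩
  · induction p using OnePoint.rec with
    | infty => rw [hinf]; exact hV.rankOne 0
    | coe z => rw [hcoe]; exact hU.rankOne z
  · rw [hplane]; exact hU
  · rw [hplane]; exact hUs
  · rw [hinversion]; exact hVs

theorem raise_properties {P : OnePoint ℂ → Mat N} (hP : IsSolution P)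
    (hproj : ∀ p, IsRankOneProjector (P p)) (k : ℕ) :
    HasNormalization (raiseNum (planePart P)) ∧
      ((∀ p, raise P p = 0) ∨ ∀ p, IsRankOneProjector (raise P p)) ∧
      IsCk k (raise P) ∧ IsSolution (raise P) ∧ HasFiniteAction (raise P) := by
  obtain ⟨hn, h | ⟨hr, hU, hUs, hVs⟩⟩ := exists_smooth_normalization hP hproj
  · have h0 : raise P = fun _ => 0 := funext h
    have hck : ∀ m : ℕ, IsCk m (fun _ => 0 : OnePoint ℂ → Mat N) := fun m =>
      ⟨fun i j => contDiff_const (c := (0 : ℂ)), fun i j => contDiff_const (c := (0 : ℂ))⟩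
    refine ⟨hn, Or.inl h, ?_⟩
    rw [h0]
    have hpl : planePart (fun _ => 0 : OnePoint ℂ → Mat N) = fun _ => 0 := rfl
    refine ⟨hck k, ⟨hck 2, fun z => by rw [hpl, mul_zero, zero_mul, sub_zero]⟩, ?_⟩
    obtain ⟨h1, h2⟩ := isCk_iff.1 (hck 1)
    exact hasFiniteAction_of_contDiff (by exact_mod_cast h1) (by exact_mod_cast h2)
  · have h1 := contDiff_infty.1 hUs
    have h2 := contDiff_infty.1 hVs
    refine ⟨hn, Or.inr hr, isCk_iff.2 ⟨h1 k, h2 k⟩, hU.isSolution (by exact_mod_cast h2 2), ?_⟩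
    exact hasFiniteAction_of_contDiff (by exact_mod_cast h1 1) (by exact_mod_cast h2 1)

theorem lower_properties {P : OnePoint ℂ → Mat N} (hP : IsSolution P)
    (hproj : ∀ p, IsRankOneProjector (P p)) (k : ℕ) :
    HasNormalization (lowerNum (planePart P)) ∧
      ((∀ p, lower P p = 0) ∨ ∀ p, IsRankOneProjector (lower P p)) ∧
      IsCk k (lower P) ∧ IsSolution (lower P) ∧ HasFiniteAction (lower P) := by
  obtain ⟨hn, hr, hk, hs, hf⟩ :=
    raise_properties hP.transpose (fun p => (hproj p).transpose) k
  obtain ⟨hn', heq⟩ := lower_eq_transpose_raise hn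
  rw [heq]
  refine ⟨hn', hr.imp (fun h p => by simp only [h, Matrix.transpose_zero])
    fun h p => (h p).transpose,
    hk.transpose, hs.transpose, ?_⟩
  rw [HasFiniteAction, lagrangian_transpose]
  exact hf

end Sphere

end CPModel

theorem theorem5 (N M : ℕ) (P : OnePoint ℂ → CPModel.Mat N)
    (hproj : ∀ p, CPModel.IsRankOneProjector (P p))
    (hC : CPModel.IsCk (M + 2) P)
    (hsol : CPModel.IsSolution P)
    (hfin : CPModel.HasFiniteAction P) :
    (CPModel.HasNormalization (CPModel.raiseNum (CPModel.planePart P)) ∧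
      ((∀ p, CPModel.raise P p = 0) ∨ ∀ p, CPModel.IsRankOneProjector (CPModel.raise P p)) ∧
      CPModel.IsCk (M + 1) (CPModel.raise P) ∧
      CPModel.IsSolution (CPModel.raise P) ∧
      CPModel.HasFiniteAction (CPModel.raise P)) ∧
    (CPModel.HasNormalization (CPModel.lowerNum (CPModel.planePart P)) ∧
      ((∀ p, CPModel.lower P p = 0) ∨ ∀ p, CPModel.IsRankOneProjector (CPModel.lower P p)) ∧
      CPModel.IsCk (M + 1) (CPModel.lower P) ∧
      CPModel.IsSolution (CPModel.lower P) ∧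
      CPModel.HasFiniteAction (CPModel.lower P)) :=
  ⟨CPModel.raise_properties hsol hproj (M + 1), CPModel.lower_properties hsol hproj (M + 1)⟩
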